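/- **Infinite three-dimensional chess.** The board is $\mathbb Z\times\mathbb Z\times\mathbb Z$. A *position* assigns to every cell either nothing or one piece (a king, queen, rook, bishop, knight or pawn, white or black), possibly infinitely many pieces in all, with at most one king of each color, together with an indication of whose turn it is. Rooks move any distance along the six directions $(\pm1,0,0),(0,\pm1,0),(0,0,\pm1)$; bishops any distance along the twelve directions $(\pm1,\pm1,0),(\pm1,0,\pm1),(0,\pm1,\pm1)$; queens like a rook or a bishop; kings one step in a direction of a queen; knights jump by $(\pm2,\pm1,0)$ or a coordinate permutation of it. None of the sliding pieces may jump over another piece. White pawns advance one step by $(0,1,0)$ to an empty cell and capture by $(\pm1,1,0)$ or $(0,1,\pm1)$; black pawns do the same with $(0,-1,0)$ and $(\pm1,-1,0)$, $(0,-1,\pm1)$. A piece captures an opposing piece by moving to its cell; no player may make a move after which the own king is attacked. There is no castling, pawn double step, en passant capture or promotion. White has won when black is to move, the black king is attacked and black has no legal move (checkmate). Stalemate and infinite play are draws. (A given starting position in which the king of the player not to move is attacked is regarded as already won by the player to move: the game is over and there are no legal moves.) The *game value* (for white) of a position is the ordinal defined, for some positions, by recursion. Positions in which white has already won have value $0$.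 If white is to move in any other position $p$, then $p$ has value $\alpha+1$ if and only if $\alpha$ is minimal such that white can legally move from $p$ to a position with value $\alpha$. If black is to move in any other position $p$, black has a legal move from $p$, and every legal move of black from $p$ leads to a position with a value, then the value of $p$ is the supremum of these values. The *omega one* $\omega_1^{\mathfrak{Ch}_3}$ of infinite three-dimensional chess with arbitrary positions is the supremum of all game values of positions. **Theorem.** Every countable ordinal is the game value of some position in infinite three-dimensional chess. Hence the game values are bounded and $\omega_1^{\mathfrak{Ch}_3}=\omega_1$. -/

import Mathlib

/-! # Infinite three-dimensional chess and transfinite game values -/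

namespace Chess3D

/-- The cells of the board `ℤ × ℤ × ℤ`. In `(x, y, z)` the axis of `y` is the one along which pawns
advance. -/
abbrev Cell : Type := ℤ × ℤ × ℤ

inductive Color
  | white
  | black

/-- The opponent. -/
def Color.other : Color → Color
  | .white => .black
  | .black => .white

inductive Kind
  | king
  | queen
  | rook
  | bishop
  | knight
  | pawn

structure Piece where
  color : Color
  kind : Kind

/-- A board position: every cell is empty (`none`) or holds one piece. Infinitely many pieces are
allowed. -/
abbrev Board : Type := Cell → Option Piece

/-- The square of the Euclidean length of a displacement. -/
def sqLen (d : Cell) : ℤ := d.1 ^ 2 + d.2.1 ^ 2 + d.2.2 ^ 2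

/-- The six orthogonal unit steps `(±1, 0, 0)`, `(0, ±1, 0)`, `(0, 0, ±1)`. -/
def IsOrthogonalStep (d : Cell) : Prop := sqLen d = 1

/-- The twelve steps along a same-colored diagonal: `(±1, ±1, 0)`, `(±1, 0, ±1)`, `(0, ±1, ±1)`.
The long diagonals `(±1, ±1, ±1)` are not included. -/
def IsDiagonalStep (d : Cell) : Prop := sqLen d = 2

/-- The twenty-four knight jumps: `(±2, ±1, 0)` and its permutations. -/
def IsKnightStep (d : Cell) : Prop := sqLen d = 5

/-- One step in the forward direction for pawns. -/
def forward : Color → Cell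
  | .white => (0, 1, 0)
  | .black => (0, -1, 0)

/-- `b` is reached from `a` by `n ≥ 1` steps `d`, all cells strictly in between being empty. -/
def Slides (B : Board) (d a b : Cell) : Prop :=
  ∃ n : ℕ, 1 ≤ n ∧ b = a + n • d ∧ ∀ k : ℕ, 1 ≤ k → k < n → B (a + k • d) = none

/-- On the board `B`, a piece `P` standing on `a` attacks the cell `b`. For a pawn these are the
four cells one step ahead on its forward diagonals. -/
def PieceAttacks (B : Board) (P : Piece) (a b : Cell) : Prop :=
  match P.kind with
  | .king => IsOrthogonalStep (b - a) ∨ IsDiagonalStep (b - a)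
  | .queen => ∃ d, (IsOrthogonalStep d ∨ IsDiagonalStep d) ∧ Slides B d a b
  | .rook => ∃ d, IsOrthogonalStep d ∧ Slides B d a b
  | .bishop => ∃ d, IsDiagonalStep d ∧ Slides B d a b
  | .knight => IsKnightStep (b - a)
  | .pawn => ∃ e : Cell, IsOrthogonalStep e ∧ e.2.1 = 0 ∧ b = a + forward P.color + e

/-- The king of color `c` is attacked by some piece of the opponent. (False if there is no such
king.) -/
def InCheck (B : Board) (c : Color) : Prop :=
  ∃ k a : Cell, ∃ P : Piece, B k = some ⟨c, .king⟩ ∧ B a = some P ∧ P.color = c.other ∧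
    PieceAttacks B P a k

/-- The player `c` has a piece on `a` that can go to `b` according to the movement rules, disregarding
the safety of the kings: it captures an opposing piece that it attacks, or it goes to
an empty cell, which for a pawn is the cell directly ahead and for the others an attacked cell. -/
def CanMove (B : Board) (c : Color) (a b : Cell) : Prop :=
  ∃ P : Piece, B a = some P ∧ P.color = c ∧
    ((∃ Q : Piece, B b = some Q ∧ Q.color = c.other ∧ PieceAttacks B P a b) ∨
      (B b = none ∧ P.kind ≠ .pawn ∧ PieceAttacks B P a b) ∨
      (B b = none ∧ P.kind = .pawn ∧ b = a + forward c))

/-- The board after the piece on `a` went to `b`, capturing whatever stood there. -/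
def movePiece (B : Board) (a b : Cell) : Board :=
  Function.update (Function.update B b (B a)) a none

/-- A position: a board position in which each side has at most one king, and whose turn it is. -/
structure Position where
  board : Board
  turn : Color
  king_unique : ∀ (c : Color) (a b : Cell),
    board a = some ⟨c, .king⟩ → board b = some ⟨c, .king⟩ → a = b

/-- The king of the player who is not to move is attacked. No legal move leads to such a position; if
it is nevertheless given as a starting position, then the game is over and the player to move, who
could capture the opposing king, has won. -/
def Position.OpponentInCheck (p : Position) : Prop := InCheck p.board p.turn.other

/-- The player to move may legally move from `p` to `q`; after the move the mover must not be
in check. There is no castling, no pawn double step, no en passant capture and no promotion. -/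
def LegalMove (p q : Position) : Prop :=
  ¬ p.OpponentInCheck ∧ q.turn = p.turn.other ∧
    (∃ a b : Cell, CanMove p.board p.turn a b ∧ q.board = movePiece p.board a b) ∧
    ¬ InCheck q.board p.turn

/-- The player to move has been checkmated: in check, without a legal move (and the opposing
king cannot be captured, which would end the game first). -/
def Position.Checkmated (p : Position) : Prop :=
  ¬ p.OpponentInCheck ∧ InCheck p.board p.turn ∧ ∀ q, ¬ LegalMove p q

/-- White has already won: black is to play and is checkmated, or, in the degenerate case
of a starting position, white is to play while the black king is attacked. -/
def WhiteHasWon (p : Position) : Prop :=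
  (p.turn = .black ∧ p.Checkmated) ∨ (p.turn = .white ∧ p.OpponentInCheck)

/-- The recursion that defines the game value (for white); `none` means that there is no value. -/
structure IsValuation (v : Position → Option Ordinal.{0}) : Prop where
  /-- Positions that white has won have value `0`. -/
  won : ∀ p, WhiteHasWon p → v p = some 0
  /-- With white to move, the value is `β + 1`, where `β` is minimal such that white may legally
  move to a position with value `β`. -/
  white : ∀ p, ¬ WhiteHasWon p → p.turn = .white → ∀ α, v p = some α ↔
    ∃ β, α = β + 1 ∧ IsLeast {γ | ∃ q, LegalMove p q ∧ v q = some γ} β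
  /-- With black to move, where black has a legal move and every legal move leads to a position
  with a value, the value is the supremum of these values. -/
  black : ∀ p, ¬ WhiteHasWon p → p.turn = .black → ∀ α, v p = some α ↔
    (∃ q, LegalMove p q) ∧ (∀ q, LegalMove p q → ∃ γ, v q = some γ) ∧
      IsLUB {γ | ∃ q, LegalMove p q ∧ v q = some γ} α

/-! The recursion has exactly one solution. -/

/-- Auxiliary: `p` has a value, and it is at most `α`. -/
inductive ValueLE : Position → Ordinal.{0} → Prop
  | won (p : Position) (α : Ordinal.{0}) : WhiteHasWon p → ValueLE p α
  | white (p q : Position) (α β : Ordinal.{0}) : p.turn = .white → LegalMove p q → ValueLE q β →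
      β < α → ValueLE p α
  | black (p : Position) (α : Ordinal.{0}) : p.turn = .black → (∃ q, LegalMove p q) →
      (∀ q, LegalMove p q → ValueLE q α) → ValueLE p α

theorem ValueLE.mono {p : Position} {α : Ordinal.{0}} (h : ValueLE p α) :
    ∀ {β : Ordinal.{0}}, α ≤ β → ValueLE p β := by
  induction h with
  | won p α h => intro β _; exact .won _ _ h
  | white p q α γ h1 h2 h3 h4 _ => intro β hb; exact .white _ _ _ _ h1 h2 h3 (h4.trans_le hb)
  | black p α h1 h2 _ ih => intro β hb; exact .black _ _ h1 h2 (fun q hq => ih q hq hb)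

open Classical in
/-- Auxiliary: the least upper bound of the value. -/
noncomputable def leastValue (p : Position) : Option Ordinal.{0} :=
  if ∃ α, ValueLE p α then some (sInf {α | ValueLE p α}) else none

theorem leastValue_eq_some {p : Position} {α : Ordinal.{0}} :
    leastValue p = some α ↔ IsLeast {α | ValueLE p α} α := by
  unfold leastValue
  split_ifs with h
  · have hl : IsLeast {α | ValueLE p α} (sInf {α | ValueLE p α}) :=
      ⟨csInf_mem h, fun b hb => csInf_le' hb⟩
    constructor
    · intro e
      rw [← Option.some.inj e]
      exact hl
    · intro e
      rw [hl.unique e]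
  · constructor
    · intro e
      cases e
    · intro e
      exact absurd ⟨α, e.1⟩ h

theorem ValueLE.exists_value {p : Position} {α : Ordinal.{0}} (h : ValueLE p α) :
    ∃ β ≤ α, leastValue p = some β :=
  ⟨sInf {α | ValueLE p α}, csInf_le' h,
    leastValue_eq_some.2 ⟨csInf_mem ⟨α, h⟩, fun _ hb => csInf_le' hb⟩⟩

theorem isValuation_leastValue : IsValuation leastValue where
  won p h := leastValue_eq_some.2 ⟨.won _ _ h, fun _ _ => zero_le⟩
  white p hn ht α := by
    have inv : ∀ δ, ValueLE p δ → ∃ q β, LegalMove p q ∧ ValueLE q β ∧ β < δ := by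
      intro δ h
      cases h with
      | won _ _ h => exact absurd h hn
      | white _ q _ β _ h2 h3 h4 => exact ⟨q, β, h2, h3, h4⟩
      | black _ _ h => rw [ht] at h; cases h
    rw [leastValue_eq_some]
    constructor
    · rintro ⟨hα, hmin⟩
      obtain ⟨q, β, hq, hβ, hlt⟩ := inv α hα
      obtain ⟨γ, hγβ, hγ⟩ := hβ.exists_value
      have key : ∀ q' δ, LegalMove p q' → leastValue q' = some δ → α ≤ δ + 1 := by
        intro q' δ hq' hδ
        exact hmin (.white p q' _ δ ht hq' (leastValue_eq_some.1 hδ).1 (Order.lt_add_one_iff.2 le_rfl))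
      have e : α = γ + 1 :=
        le_antisymm (key q γ hq hγ) (Order.add_one_le_of_lt (hγβ.trans_lt hlt))
      refine ⟨γ, e, ⟨q, hq, hγ⟩, ?_⟩
      rintro δ ⟨q', hq', hδ⟩
      have := key q' δ hq' hδ
      rw [e] at this
      exact Order.lt_add_one_iff.1 ((Order.lt_add_one_iff.2 le_rfl).trans_le this)
    · rintro ⟨β, rfl, ⟨q, hq, hβ⟩, hmin⟩
      refine ⟨.white p q _ β ht hq (leastValue_eq_some.1 hβ).1 (Order.lt_add_one_iff.2 le_rfl), ?_⟩
      intro δ hδ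
      obtain ⟨q', β', hq', hβ', hlt⟩ := inv δ hδ
      obtain ⟨γ, hγβ, hγ⟩ := hβ'.exists_value
      exact Order.add_one_le_of_lt (((hmin ⟨q', hq', hγ⟩).trans hγβ).trans_lt hlt)
  black p hn ht α := by
    have inv : ∀ δ, ValueLE p δ → (∃ q, LegalMove p q) ∧ ∀ q, LegalMove p q → ValueLE q δ := by
      intro δ h
      cases h with
      | won _ _ h => exact absurd h hn
      | white _ q _ β h => rw [ht] at h; cases h
      | black _ _ _ h2 h3 => exact ⟨h2, h3⟩
    rw [leastValue_eq_some]
    constructor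
    · rintro ⟨hα, hmin⟩
      obtain ⟨hex, hall⟩ := inv α hα
      have hv : ∀ q, LegalMove p q → ∃ γ, leastValue q = some γ := fun q hq =>
        let ⟨γ, _, h⟩ := (hall q hq).exists_value
        ⟨γ, h⟩
      refine ⟨hex, hv, ?_, ?_⟩
      · rintro γ ⟨q, hq, hγ⟩
        exact (leastValue_eq_some.1 hγ).2 (hall q hq)
      · intro δ hδ
        refine hmin (.black p δ ht hex fun q hq => ?_)
        obtain ⟨γ, hγ⟩ := hv q hq
        exact (leastValue_eq_some.1 hγ).1.mono (hδ ⟨q, hq, hγ⟩)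
    · rintro ⟨hex, hv, hub, hlub⟩
      refine ⟨.black p α ht hex fun q hq => ?_, ?_⟩
      · obtain ⟨γ, hγ⟩ := hv q hq
        exact (leastValue_eq_some.1 hγ).1.mono (hub ⟨q, hq, hγ⟩)
      · intro δ hδ
        refine hlub ?_
        rintro γ ⟨q, hq, hγ⟩
        exact (leastValue_eq_some.1 hγ).2 ((inv δ hδ).2 q hq)

theorem LegalMove.turn_eq {p q : Position} (h : LegalMove p q) : q.turn = p.turn.other := h.2.1

/-- A position that has a value under one solution of the recursion has it under every solution. -/
theorem IsValuation.eq_some {v w : Position → Option Ordinal.{0}} (hv : IsValuation v)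
    (hw : IsValuation w) :
    ∀ (α : Ordinal.{0}) (p : Position), v p = some α → w p = some α := by
  suffices key : ∀ α : Ordinal.{0}, ∀ v w, IsValuation v → IsValuation w → ∀ p : Position,
      (p.turn = .black → v p = some α → w p = some α) ∧
      (p.turn = .white → v p = some α → w p = some α) by
    intro α p h
    cases ht : p.turn with
    | white => exact (key α v w hv hw p).2 ht h
    | black => exact (key α v w hv hw p).1 ht h
  intro α
  induction α using WellFoundedLT.induction with
  | _ α ih =>
    have any : ∀ β, β < α → ∀ v w, IsValuation v → IsValuation w → ∀ p, v p = some β →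
        w p = some β := by
      intro β hβ v w hv hw p h
      cases ht : p.turn with
      | white => exact (ih β hβ v w hv hw p).2 ht h
      | black => exact (ih β hβ v w hv hw p).1 ht h
    have hwhite : ∀ β, β ≤ α → ∀ v w, IsValuation v → IsValuation w → ∀ p : Position,
        p.turn = .white → v p = some β → w p = some β := by
      intro β hβ v w hv hw p ht h
      by_cases hn : WhiteHasWon p
      · rw [hw.won p hn, ← hv.won p hn, h]
      · obtain ⟨γ, rfl, ⟨q, hq, hqγ⟩, hmin⟩ := (hv.white p hn ht _).1 h
        have hγ : γ < α := (Order.lt_add_one_iff.2 le_rfl).trans_le hβ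
        refine (hw.white p hn ht _).2 ⟨γ, rfl, ⟨q, hq, any γ hγ v w hv hw q hqγ⟩, ?_⟩
        rintro δ ⟨q', hq', hδ⟩
        by_contra hlt
        rw [not_le] at hlt
        exact absurd (hmin ⟨q', hq', any δ (hlt.trans hγ) w v hw hv q' hδ⟩) (not_le.2 hlt)
    intro v w hv hw p
    refine ⟨fun ht h => ?_, fun ht h => hwhite α le_rfl v w hv hw p ht h⟩
    by_cases hn : WhiteHasWon p
    · rw [hw.won p hn, ← hv.won p hn, h]
    · obtain ⟨hex, hall, hlub⟩ := (hv.black p hn ht _).1 h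
      have tr : ∀ q, LegalMove p q → ∀ γ, v q = some γ → w q = some γ := by
        intro q hq γ hγ
        have hqt : q.turn = .white := by rw [hq.turn_eq, ht]; rfl
        exact hwhite γ (hlub.1 ⟨q, hq, hγ⟩) v w hv hw q hqt hγ
      have hset : {γ | ∃ q, LegalMove p q ∧ w q = some γ} =
          {γ | ∃ q, LegalMove p q ∧ v q = some γ} := by
        ext γ
        constructor
        · rintro ⟨q, hq, hγ⟩
          obtain ⟨δ, hδ⟩ := hall q hq
          have e := tr q hq δ hδ
          rw [hγ] at e
          exact ⟨q, hq, by rw [hδ, ← e]⟩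
        · rintro ⟨q, hq, hγ⟩
          exact ⟨q, hq, tr q hq γ hγ⟩
      refine (hw.black p hn ht _).2 ⟨hex, fun q hq => ?_, hset ▸ hlub⟩
      obtain ⟨δ, hδ⟩ := hall q hq
      exact ⟨δ, tr q hq δ hδ⟩

theorem existsUnique_valuation : ∃! v, IsValuation v := by
  refine ⟨leastValue, isValuation_leastValue, fun w hw => ?_⟩
  funext p
  exact Option.ext fun α =>
    ⟨fun h => hw.eq_some isValuation_leastValue α p h,
      fun h => isValuation_leastValue.eq_some hw α p h⟩

/-- The game value (for white) of a position: the unique solution of the defining recursion. -/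
noncomputable def gameValue : Position → Option Ordinal.{0} := existsUnique_valuation.choose

theorem isValuation_gameValue : IsValuation gameValue := existsUnique_valuation.choose_spec.1

/-- The positions with value `0` are precisely those in which white has already won. -/
theorem gameValue_eq_zero_iff (p : Position) : gameValue p = some 0 ↔ WhiteHasWon p := by
  refine ⟨fun h => ?_, isValuation_gameValue.won p⟩
  by_contra hn
  have W : ∀ p : Position, p.turn = .white → gameValue p = some 0 → WhiteHasWon p := by
    intro p ht h
    by_contra hn
    obtain ⟨β, e, _⟩ := (isValuation_gameValue.white p hn ht 0).1 h
    have hh : β < β + 1 := Order.lt_add_one_iff.2 le_rfl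
    rw [← e] at hh
    exact absurd hh not_lt_zero
  cases ht : p.turn with
  | white => exact hn (W p ht h)
  | black =>
    obtain ⟨⟨q, hq⟩, hv, hl⟩ := (isValuation_gameValue.black p hn ht 0).1 h
    obtain ⟨γ, hγ⟩ := hv q hq
    have : γ ≤ 0 := hl.1 ⟨q, hq, hγ⟩
    simp at this; subst this
    have hqt : q.turn = .white := by rw [hq.turn_eq, ht]; rfl
    rcases W q hqt hγ with h' | h'
    · rw [hqt] at h'; simp at h'
    · have := hq.2.2.2
      rw [ht] at this
      simp [Position.OpponentInCheck, hqt, Color.other] at h'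
      exact this h'

/-- The ordinals that are game values of positions, equivalently of winning positions for white,
finite or infinite. -/
def gameValues : Set Ordinal.{0} := {α | ∃ p : Position, gameValue p = some α}

/-- The omega one of infinite three-dimensional chess (for arbitrary positions): the
supremum of the game values. -/
noncomputable def omegaOneChess : Ordinal.{0} := sSup gameValues

end Chess3D

/-!
Game values are countable (`lt_omega_one_of_mem_gameValues`), because a position has only countably
many legal moves, and they form an initial segment of the ordinals (`mem_gameValues_of_le`). Hence
it suffices to find, for every countable ordinal `α`, a position with a value that is at least `α`.

Such a position is built so that almost nothing can move. Call a cell even or odd by the sum of its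
coordinates. All odd cells but one hold black bishops. Diagonal steps preserve the parity and all
other steps of length one, as well as knight jumps, reverse it; so the odd bishops are blocked for
ever by each other, and on the even cells bishops are the only pieces that move freely: pawns
cannot advance but only capture, and black knights are inert bricks. White has no king. The black
king sits far below the rest in a net of blocked pieces, and the one black piece on an odd cell
that is not a bishop, the fatal pawn, may always advance next to the net; white then mates by
capturing it, which uncovers the line of the white bishop (`Frozen.hasValue_fatal`). So black is
never stalemated, and loses at once when no other move is left (`Frozen.hasValue`).

The even cells of one horizontal level form a square grid with respect to the two horizontal
diagonals. A countable tree is embedded in the levels above: a node of length `n` gets a straight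
tunnel of empty cells in level `n`, parallel to one of the axes, with axes alternating from level
to level. At the start of the tunnel of `w` are a black bishop, walled in by black knights, and a
black pawn of `w` that locks it in (the pawn is missing at the root); this pawn attacks a cell of
the tunnel of the parent, the junction of `w`. White pawns one level below cover the tunnel. When
the game is at the node `s` (`AtNode`), the bishop of `s` is free. If black moves it to the
junction of a child `w`, then white has to capture it, there being no other white move on the whole
board; the pawn of `w` recaptures and thereby frees the bishop of `w`; white recaptures with a
second cover, and the game is at `w` (`AtNode.exchange`). Thus black can descend in the tree as
slowly as the ordinal allows (`AtNode.exists_child`, `rankOf_le`). Wherever else the bishop goes in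
its tunnel, it is captured and only the fatal advance is left, so that white wins whenever the tree
is well-founded (`AtNode.hasValue_of_children`, `hasValue_of_atNode`). The tree of strictly
decreasing sequences of ordinals below `α` has rank `α`.
-/

/-! ### The order theory of game values -/

namespace Chess3D

theorem gameValue_eq_leastValue : gameValue = leastValue :=
  existsUnique_valuation.unique isValuation_gameValue isValuation_leastValue

theorem exists_le_gameValue {p : Position} {α β : Ordinal.{0}} (h : ValueLE p β)
    (hα : ∀ γ, ValueLE p γ → α ≤ γ) : ∃ γ, α ≤ γ ∧ gameValue p = some γ := by
  obtain ⟨γ, -, hγ⟩ := h.exists_value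
  exact ⟨γ, hα γ (leastValue_eq_some.1 hγ).1, by rw [gameValue_eq_leastValue, hγ]⟩

theorem gameValue_white_eq_some {p : Position} {α : Ordinal.{0}} (ht : p.turn = .white)
    (h : gameValue p = some α) (h0 : α ≠ 0) :
    ∃ β q, α = β + 1 ∧ LegalMove p q ∧ gameValue q = some β := by
  have hn : ¬ WhiteHasWon p := fun hw => h0 (by
    have := (gameValue_eq_zero_iff p).2 hw
    rw [h] at this
    exact Option.some.inj this)
  obtain ⟨β, e, ⟨q, hq, hqβ⟩, -⟩ := (isValuation_gameValue.white p hn ht α).1 h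
  exact ⟨β, q, e, hq, hqβ⟩

theorem gameValue_black_eq_some {p : Position} {α : Ordinal.{0}} (ht : p.turn = .black)
    (h : gameValue p = some α) (h0 : α ≠ 0) :
    IsLUB {γ | ∃ q, LegalMove p q ∧ gameValue q = some γ} α := by
  have hn : ¬ WhiteHasWon p := fun hw => h0 (by
    have := (gameValue_eq_zero_iff p).2 hw
    rw [h] at this
    exact Option.some.inj this)
  exact ((isValuation_gameValue.black p hn ht α).1 h).2.2

/-- Every ordinal below a game value is a game value. -/
theorem mem_gameValues_of_le {α β : Ordinal.{0}} (hα : α ∈ gameValues) (h : β ≤ α) :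
    β ∈ gameValues := by
  -- A value of a position with white to move is a successor `γ + 1`, and `γ` is a value; a value
  -- of a position with black to move is a supremum of values of positions with white to move.
  suffices key : ∀ α : Ordinal.{0},
      (∀ p : Position, p.turn = .white → gameValue p = some α → ∀ β ≤ α, β ∈ gameValues) ∧
      (∀ p : Position, p.turn = .black → gameValue p = some α → ∀ β ≤ α, β ∈ gameValues) by
    obtain ⟨p, hp⟩ := hα
    cases ht : p.turn with
    | white => exact (key α).1 p ht hp β h
    | black => exact (key α).2 p ht hp β h
  intro α
  induction α using WellFoundedLT.induction with
  | _ α ih =>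
    have hw : ∀ p : Position, p.turn = .white → gameValue p = some α →
        ∀ β ≤ α, β ∈ gameValues := by
      intro p ht hp β hβ
      rcases hβ.eq_or_lt with rfl | hlt
      · exact ⟨p, hp⟩
      obtain ⟨γ, q, rfl, hq, hqγ⟩ := gameValue_white_eq_some ht hp
        (fun h0 => by subst h0; exact absurd hlt not_lt_zero)
      refine (ih γ (Order.lt_add_one_iff.2 le_rfl)).2 q ?_ hqγ β (Order.lt_add_one_iff.1 hlt)
      rw [hq.turn_eq, ht]; rfl
    refine ⟨hw, fun p ht hp β hβ => ?_⟩
    rcases hβ.eq_or_lt with rfl | hlt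
    · exact ⟨p, hp⟩
    have hl := gameValue_black_eq_some ht hp
      (fun h0 => by subst h0; exact absurd hlt not_lt_zero)
    obtain ⟨δ, ⟨q, hq, hδ⟩, hβδ⟩ := (lt_isLUB_iff hl).1 hlt
    have hqt : q.turn = .white := by rw [hq.turn_eq, ht]; rfl
    rcases (hl.1 ⟨q, hq, hδ⟩ : δ ≤ α).eq_or_lt with rfl | hlt'
    · exact hw q hqt hδ β hβδ.le
    · exact (ih δ hlt').1 q hqt hδ β hβδ.le

theorem card_le_aleph0_iff {α : Ordinal.{0}} :
    α.card ≤ Cardinal.aleph0 ↔ α < Ordinal.omega 1 := by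
  rw [← Cardinal.ord_aleph, Cardinal.lt_ord, ← Cardinal.succ_aleph0, Order.lt_succ_iff]

theorem countable_legalMove_values (p : Position) :
    {γ | ∃ q, LegalMove p q ∧ gameValue q = some γ}.Countable := by
  -- A legal successor is determined by the two cells of the move.
  have hc : {q | LegalMove p q}.Countable := by
    have : ∀ q : {q | LegalMove p q}, ∃ m : Cell × Cell, q.1.board = movePiece p.board m.1 m.2 :=
      fun q => let ⟨a, b, _, h⟩ := q.2.2.2.1; ⟨(a, b), h⟩
    choose m hm using this
    refine Set.countable_coe_iff.1 (Function.Injective.countable (f := m) ?_)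
    intro q r h
    have hb : q.1.board = r.1.board := by rw [hm q, hm r, h]
    have ht : q.1.turn = r.1.turn := by rw [q.2.turn_eq, r.2.turn_eq]
    obtain ⟨⟨B, t, k⟩, _⟩ := q
    obtain ⟨⟨B', t', k'⟩, _⟩ := r
    simp only at hb ht
    subst hb ht
    rfl
  have hsub : {γ | ∃ q, LegalMove p q ∧ gameValue q = some γ} ⊆
      (fun q => (gameValue q).getD 0) '' {q | LegalMove p q} := by
    rintro γ ⟨q, hq, hγ⟩
    exact ⟨q, hq, by simp [hγ]⟩
  exact (hc.image _).mono hsub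

/-- Every game value is a countable ordinal: each position has countably many legal moves. -/
theorem lt_omega_one_of_mem_gameValues {α : Ordinal.{0}} (hα : α ∈ gameValues) :
    α < Ordinal.omega 1 := by
  suffices key : ∀ α : Ordinal.{0},
      (∀ p : Position, p.turn = .white → gameValue p = some α → α < Ordinal.omega 1) ∧
      (∀ p : Position, p.turn = .black → gameValue p = some α → α < Ordinal.omega 1) by
    obtain ⟨p, hp⟩ := hα
    cases ht : p.turn with
    | white => exact (key α).1 p ht hp
    | black => exact (key α).2 p ht hp
  have hpos : (0 : Ordinal.{0}) < Ordinal.omega 1 := Ordinal.omega_pos 1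
  intro α
  induction α using WellFoundedLT.induction with
  | _ α ih =>
    have hw : ∀ p : Position, p.turn = .white → gameValue p = some α → α < Ordinal.omega 1 := by
      intro p ht hp
      by_cases h0 : α = 0
      · rwa [h0]
      obtain ⟨γ, q, rfl, hq, hqγ⟩ := gameValue_white_eq_some ht hp h0
      refine (Cardinal.isSuccLimit_omega 1).add_one_lt
        ((ih γ (Order.lt_add_one_iff.2 le_rfl)).2 q ?_ hqγ)
      rw [hq.turn_eq, ht]; rfl
    refine ⟨hw, fun p ht hp => ?_⟩
    by_cases h0 : α = 0
    · rwa [h0]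
    have hl := gameValue_black_eq_some ht hp h0
    have := (countable_legalMove_values p).to_subtype
    have hlt : ∀ γ : {γ | ∃ q, LegalMove p q ∧ gameValue q = some γ}, γ.1 < Ordinal.omega 1 := by
      rintro ⟨γ, q, hq, hγ⟩
      have hqt : q.turn = .white := by rw [hq.turn_eq, ht]; rfl
      rcases (hl.1 ⟨q, hq, hγ⟩ : γ ≤ α).eq_or_lt with rfl | hlt'
      · exact hw q hqt hγ
      · exact (ih γ hlt').1 q hqt hγ
    refine lt_of_le_of_lt (hl.2 ?_) (Ordinal.iSup_lt_omega_one hlt)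
    intro γ hγ
    exact le_ciSup (f := fun γ : {γ | ∃ q, LegalMove p q ∧ gameValue q = some γ} => γ.1)
      ⟨α, by rintro _ ⟨γ, rfl⟩; exact hl.1 γ.2⟩ ⟨γ, hγ⟩

/-- The position `p` has a game value. -/
def HasValue (p : Position) : Prop := ∃ α, ValueLE p α

theorem HasValue.of_white {p q : Position} (ht : p.turn = .white) (h : LegalMove p q)
    (hq : HasValue q) : HasValue p := by
  obtain ⟨β, hβ⟩ := hq
  exact ⟨β + 1, .white p q _ β ht h hβ (Order.lt_add_one_iff.2 le_rfl)⟩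

theorem HasValue.of_black {p : Position} (ht : p.turn = .black) (hex : ∃ q, LegalMove p q)
    (h : ∀ q, LegalMove p q → HasValue q) : HasValue p := by
  choose f hf using fun q : {q // LegalMove p q} => h q.1 q.2
  refine ⟨⨆ q, f q, .black p _ ht hex fun q hq => (hf ⟨q, hq⟩).mono ?_⟩
  exact le_ciSup (Ordinal.bddAbove_of_small) (⟨q, hq⟩ : {q // LegalMove p q})

theorem ValueLE.of_black {p q : Position} {α : Ordinal.{0}} (h : ValueLE p α)
    (ht : p.turn = .black) (hq : LegalMove p q) : ValueLE q α := by
  cases h with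
  | won _ _ h =>
    rcases h with ⟨-, h⟩ | ⟨h, -⟩
    · exact absurd hq (h.2.2 q)
    · rw [ht] at h; cases h
  | white _ _ _ _ h => rw [ht] at h; cases h
  | black _ _ _ _ h => exact h q hq

theorem ValueLE.of_white {p : Position} {α : Ordinal.{0}} (h : ValueLE p α)
    (ht : p.turn = .white) (hc : ¬ InCheck p.board .black) :
    ∃ q, LegalMove p q ∧ ∃ β < α, ValueLE q β := by
  cases h with
  | won _ _ h =>
    rcases h with ⟨h, -⟩ | ⟨-, h⟩
    · rw [ht] at h; cases h
    · rw [Position.OpponentInCheck, ht] at h; exact absurd h hc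
  | white _ q _ β _ h1 h2 h3 => exact ⟨q, h1, β, h3, h2⟩
  | black _ _ h => rw [ht] at h; cases h

/-! ### Moving pieces -/

theorem movePiece_source (B : Board) (a b : Cell) : movePiece B a b a = none := by
  simp [movePiece]

theorem movePiece_target {a b : Cell} (B : Board) (h : b ≠ a) : movePiece B a b b = B a := by
  simp [movePiece, h]

theorem movePiece_of_ne {a b c : Cell} (B : Board) (ha : c ≠ a) (hb : c ≠ b) :
    movePiece B a b c = B c := by
  simp [movePiece, ha, hb]

theorem movePiece_apply (B : Board) (a b c : Cell) : movePiece B a b c =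
    if c = a then none else if c = b then B a else B c := by
  simp [movePiece, Function.update_apply]

/-- The position after a move. -/
def Position.move (p : Position) (a b : Cell) : Position where
  board := movePiece p.board a b
  turn := p.turn.other
  king_unique := by
    have key : ∀ (c : Color) (u : Cell), movePiece p.board a b u = some ⟨c, .king⟩ →
        u ≠ a ∧ ((u = b ∧ p.board a = some ⟨c, .king⟩) ∨
          (u ≠ b ∧ p.board u = some ⟨c, .king⟩)) := by
      intro c u h
      by_cases hu : u = a
      · rw [hu, movePiece_source] at h; cases h
      by_cases hb : u = b
      · subst hb; rw [movePiece_target _ hu] at h; exact ⟨hu, .inl ⟨rfl, h⟩⟩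
      · rw [movePiece_of_ne _ hu hb] at h; exact ⟨hu, .inr ⟨hb, h⟩⟩
    intro c u v hu hv
    obtain ⟨hua, ⟨rfl, h1⟩ | ⟨-, h1⟩⟩ := key c u hu <;>
      obtain ⟨hva, ⟨rfl, h2⟩ | ⟨-, h2⟩⟩ := key c v hv
    · rfl
    · exact absurd (p.king_unique c _ _ h2 h1) hva
    · exact absurd (p.king_unique c _ _ h1 h2) hua
    · exact p.king_unique c _ _ h1 h2

theorem Position.eq_move {p q : Position} {a b : Cell} (ht : q.turn = p.turn.other)
    (hb : q.board = movePiece p.board a b) : q = p.move a b := by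
  obtain ⟨B, t, k⟩ := q
  simp only at ht hb
  subst ht hb
  rfl

/-! ### Steps in the coordinates of a node -/

theorem isDiagonalStep_iff {d : Cell} : IsDiagonalStep d ↔
    (d.2.1 = 0 ∧ (d.1 = 1 ∨ d.1 = -1) ∧ (d.2.2 = 1 ∨ d.2.2 = -1)) ∨
      ((d.2.1 = 1 ∨ d.2.1 = -1) ∧ ((d.1 = 0 ∧ (d.2.2 = 1 ∨ d.2.2 = -1)) ∨
        (d.2.2 = 0 ∧ (d.1 = 1 ∨ d.1 = -1)))) := by
  obtain ⟨x, y, z⟩ := d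
  simp only [IsDiagonalStep, sqLen]
  constructor
  · intro h
    have hx : -1 ≤ x ∧ x ≤ 1 := by constructor <;> nlinarith [sq_nonneg y, sq_nonneg z]
    have hy : -1 ≤ y ∧ y ≤ 1 := by constructor <;> nlinarith [sq_nonneg x, sq_nonneg z]
    have hz : -1 ≤ z ∧ z ≤ 1 := by constructor <;> nlinarith [sq_nonneg x, sq_nonneg y]
    obtain ⟨hx1, hx2⟩ := hx
    obtain ⟨hy1, hy2⟩ := hy
    obtain ⟨hz1, hz2⟩ := hz
    interval_cases x <;> interval_cases y <;> interval_cases z <;> simp_all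
  · rintro (⟨rfl, rfl | rfl, rfl | rfl⟩ | ⟨rfl | rfl, ⟨rfl, rfl | rfl⟩ | ⟨rfl, rfl | rfl⟩⟩) <;>
      norm_num

theorem isOrthogonalStep_iff {d : Cell} : IsOrthogonalStep d ↔
    (d.1 = 0 ∧ d.2.1 = 0 ∧ (d.2.2 = 1 ∨ d.2.2 = -1)) ∨
      (d.1 = 0 ∧ (d.2.1 = 1 ∨ d.2.1 = -1) ∧ d.2.2 = 0) ∨
      ((d.1 = 1 ∨ d.1 = -1) ∧ d.2.1 = 0 ∧ d.2.2 = 0) := by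
  obtain ⟨x, y, z⟩ := d
  simp only [IsOrthogonalStep, sqLen]
  constructor
  · intro h
    have hx : -1 ≤ x ∧ x ≤ 1 := by constructor <;> nlinarith [sq_nonneg y, sq_nonneg z]
    have hy : -1 ≤ y ∧ y ≤ 1 := by constructor <;> nlinarith [sq_nonneg x, sq_nonneg z]
    have hz : -1 ≤ z ∧ z ≤ 1 := by constructor <;> nlinarith [sq_nonneg x, sq_nonneg y]
    obtain ⟨hx1, hx2⟩ := hx
    obtain ⟨hy1, hy2⟩ := hy
    obtain ⟨hz1, hz2⟩ := hz
    interval_cases x <;> interval_cases y <;> interval_cases z <;> simp_all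
  · rintro (⟨rfl, rfl, rfl | rfl⟩ | ⟨rfl, rfl | rfl, rfl⟩ | ⟨rfl | rfl, rfl, rfl⟩) <;> norm_num

/-- The cells of the class in which the game takes place. Diagonal steps preserve the class;
orthogonal steps and knight jumps leave it. -/
def EvenCell (c : Cell) : Prop := (c.1 + c.2.1 + c.2.2) % 2 = 0

theorem IsKnightStep.odd {d : Cell} (h : IsKnightStep d) : (d.1 + d.2.1 + d.2.2) % 2 = 1 := by
  obtain ⟨x, y, z⟩ := d
  simp only [IsKnightStep, sqLen] at h ⊢
  have hx := Int.emod_two_eq_zero_or_one x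
  have hy := Int.emod_two_eq_zero_or_one y
  have hz := Int.emod_two_eq_zero_or_one z
  have h2 : (x ^ 2 + y ^ 2 + z ^ 2) % 2 = 1 := by rw [h]; rfl
  rcases hx with hx | hx <;> rcases hy with hy | hy <;> rcases hz with hz | hz <;>
    simp [pow_two, Int.add_emod, Int.mul_emod, hx, hy, hz] at h2 ⊢

/-- `b` is one of the four cells that a white pawn on `a` attacks; equivalently, `a` is one of the
four cells that a black pawn on `b` attacks. -/
def UpDiag (a b : Cell) : Prop :=
  b.2.1 = a.2.1 + 1 ∧ ((b.1 = a.1 ∧ (b.2.2 = a.2.2 + 1 ∨ b.2.2 = a.2.2 - 1)) ∨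
    (b.2.2 = a.2.2 ∧ (b.1 = a.1 + 1 ∨ b.1 = a.1 - 1)))

theorem pieceAttacks_white_pawn {B : Board} {a b : Cell} :
    PieceAttacks B ⟨.white, .pawn⟩ a b ↔ UpDiag a b := by
  obtain ⟨x, y, z⟩ := a
  obtain ⟨x', y', z'⟩ := b
  simp only [PieceAttacks, forward, UpDiag, isOrthogonalStep_iff]
  constructor
  · rintro ⟨⟨u, v, w⟩, h, h0, he⟩
    simp only [Prod.mk_add_mk, Prod.mk.injEq] at h h0 he ⊢
    omega
  · intro h
    refine ⟨(x' - x, 0, z' - z), ?_, rfl, ?_⟩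
    · dsimp only; omega
    · simp only [Prod.mk_add_mk, Prod.mk.injEq]; omega

theorem pieceAttacks_black_pawn {B : Board} {a b : Cell} :
    PieceAttacks B ⟨.black, .pawn⟩ a b ↔ UpDiag b a := by
  obtain ⟨x, y, z⟩ := a
  obtain ⟨x', y', z'⟩ := b
  simp only [PieceAttacks, forward, UpDiag, isOrthogonalStep_iff]
  constructor
  · rintro ⟨⟨u, v, w⟩, h, h0, he⟩
    simp only [Prod.mk_add_mk, Prod.mk.injEq] at h h0 he ⊢
    omega
  · intro h
    refine ⟨(x' - x, 0, z' - z), ?_, rfl, ?_⟩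
    · dsimp only; omega
    · simp only [Prod.mk_add_mk, Prod.mk.injEq]; omega

/-- Twice the coordinate of a cell along the tunnel of the node `w`. The even cells of one level are
a square grid whose two axes are the horizontal diagonals; the tunnels of the nodes of even length
follow one axis, those of odd length the other. Subtracting the level `c.2.1` makes the coordinate
even on all even cells. -/
def along (w : List ℕ) (c : Cell) : ℤ :=
  if (w.length : ℤ) % 2 = 0 then c.1 + c.2.2 - c.2.1 else c.2.2 - c.1 - c.2.1

/-- Twice the coordinate of a cell across the tunnel of the node `w`. -/
def across (w : List ℕ) (c : Cell) : ℤ :=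
  if (w.length : ℤ) % 2 = 0 then c.2.2 - c.1 - c.2.1 else c.1 + c.2.2 - c.2.1

/-- The frames of two nodes are the same or have their axes exchanged. -/
theorem frame_eq_or_swap (s w : List ℕ) :
    ((s.length : ℤ) % 2 = (w.length : ℤ) % 2 ∧
      ∀ c, along s c = along w c ∧ across s c = across w c) ∨
    ((s.length : ℤ) % 2 ≠ (w.length : ℤ) % 2 ∧
      ∀ c, along s c = across w c ∧ across s c = along w c) := by
  by_cases h : (s.length : ℤ) % 2 = 0 <;> by_cases h' : (w.length : ℤ) % 2 = 0
  · exact .inl ⟨by omega, fun c => by simp [along, across, h, h']⟩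
  · exact .inr ⟨by omega, fun c => by simp [along, across, h, h']⟩
  · exact .inr ⟨by omega, fun c => by simp [along, across, h, h']⟩
  · exact .inl ⟨by omega, fun c => by simp [along, across, h, h']⟩

theorem evenCell_iff_along (w : List ℕ) (c : Cell) : EvenCell c ↔ along w c % 2 = 0 := by
  unfold EvenCell along; split_ifs <;> omega

theorem evenCell_iff_across (w : List ℕ) (c : Cell) : EvenCell c ↔ across w c % 2 = 0 := by
  unfold EvenCell across; split_ifs <;> omega

theorem cell_eq_iff (w : List ℕ) (a b : Cell) :
    a = b ↔ a.2.1 = b.2.1 ∧ along w a = along w b ∧ across w a = across w b := by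
  obtain ⟨x, y, z⟩ := a
  obtain ⟨x', y', z'⟩ := b
  simp only [Prod.mk.injEq]
  unfold along across
  split_ifs <;> constructor <;> intro h <;> simp only at h ⊢ <;> omega

theorem upDiag_iff (w : List ℕ) (a b : Cell) : UpDiag a b ↔
    b.2.1 = a.2.1 + 1 ∧ (along w b = along w a ∨ along w b = along w a - 2) ∧
      (across w b = across w a ∨ across w b = across w a - 2) := by
  unfold UpDiag along across
  split_ifs <;> constructor <;> intro h <;> omega

theorem isDiagonalStep_sub_iff (w : List ℕ) (a b : Cell) : IsDiagonalStep (b - a) ↔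
    (b.2.1 = a.2.1 ∧
      ((across w b = across w a ∧ (along w b = along w a + 2 ∨ along w b = along w a - 2)) ∨
        (along w b = along w a ∧ (across w b = across w a + 2 ∨ across w b = across w a - 2)))) ∨
    UpDiag a b ∨ UpDiag b a := by
  rw [isDiagonalStep_iff]
  simp only [Prod.fst_sub, Prod.snd_sub]
  constructor
  · rintro (⟨hy, h⟩ | ⟨hy | hy, h⟩)
    · refine .inl ⟨by omega, ?_⟩
      unfold along across
      split_ifs <;> omega
    · exact .inr (.inl ⟨by omega, by omega⟩)
    · exact .inr (.inr ⟨by omega, by omega⟩)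
  · rintro (⟨hy, h⟩ | h | h)
    · refine .inl ⟨by omega, ?_⟩
      unfold along across at h
      split_ifs at h <;> omega
    · unfold UpDiag at h
      exact .inr ⟨by omega, by omega⟩
    · unfold UpDiag at h
      exact .inr ⟨by omega, by omega⟩

/-- The cell with given coordinates in the frame of `w`. -/
def frameCell (w : List ℕ) (k h r : ℤ) : Cell :=
  if (w.length : ℤ) % 2 = 0 then (k - r, h, k + r + h) else (r - k, h, k + r + h)

theorem frameCell_spec (w : List ℕ) (k h r : ℤ) : (frameCell w k h r).2.1 = h ∧
    along w (frameCell w k h r) = 2 * k ∧ across w (frameCell w k h r) = 2 * r := by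
  by_cases hw : (w.length : ℤ) % 2 = 0
  · simp only [frameCell, along, across, hw, if_true]
    exact ⟨trivial, by omega, by omega⟩
  · simp only [frameCell, along, across, hw, if_false]
    exact ⟨trivial, by omega, by omega⟩

/-! ### The embedding of the tree -/

/-- The coordinate reserved for a node: these are injective, spaced by `16`, and increase from a node
to its children. -/
def slot (w : List ℕ) : ℤ := 16 * (Encodable.encode w : ℤ)

/-- The coordinate of the parent. -/
def parentSlot : List ℕ → ℤ
  | [] => -16
  | _ :: u => slot u

theorem slot_nonneg (w : List ℕ) : 0 ≤ slot w := by unfold slot; omega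

theorem slot_separated (u w : List ℕ) :
    u = w ∨ slot u + 16 ≤ slot w ∨ slot w + 16 ≤ slot u := by
  by_cases h : u = w
  · exact .inl h
  · have : Encodable.encode u ≠ Encodable.encode w := fun e => h (Encodable.encode_injective e)
    unfold slot
    omega

theorem parentSlot_lt (w : List ℕ) : parentSlot w + 16 ≤ slot w := by
  cases w with
  | nil => simp [parentSlot, slot]
  | cons n u =>
    have h : Encodable.encode u ≤ Nat.pair n (Encodable.encode u) := Nat.right_le_pair _ _
    have : Encodable.encode (n :: u) = Nat.pair n (Encodable.encode u) + 1 := by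
      simp [Encodable.encode_list_cons]
    simp only [parentSlot, slot]
    omega

theorem parentSlot_separated (u w : List ℕ) :
    (∃ n, w = n :: u) ∨ parentSlot w + 16 ≤ slot u ∨ slot u + 16 ≤ parentSlot w := by
  cases w with
  | nil => have := slot_nonneg u; simp only [parentSlot]; omega
  | cons n v =>
    rcases slot_separated u v with rfl | h
    · exact .inl ⟨n, rfl⟩
    · simp only [parentSlot]; omega

/-- The home of the black bishop of the node `w`. -/
def IsBishopHome (w : List ℕ) (c : Cell) : Prop :=
  c.2.1 = w.length ∧ along w c = 2 * parentSlot w - 4 ∧ across w c = 2 * slot w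

/-- The home of the black pawn of the node `w`, the first cell of its tunnel. -/
def IsPawnHome (w : List ℕ) (c : Cell) : Prop :=
  c.2.1 = w.length ∧ along w c = 2 * parentSlot w - 2 ∧ across w c = 2 * slot w

/-- The diagonal neighbors of the home of the bishop of `w` other than the home of the pawn. -/
def IsGuard (w : List ℕ) (c : Cell) : Prop :=
  (∃ b, IsBishopHome w b ∧ IsDiagonalStep (c - b)) ∧ ¬ IsPawnHome w c

/-- The tunnel of the node `w`: the ray on which its bishop moves. -/
def IsTunnel (w : List ℕ) (c : Cell) : Prop :=
  c.2.1 = w.length ∧ 2 * parentSlot w - 2 ≤ along w c ∧ across w c = 2 * slot w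

/-- The cells below the tunnel of `w` from which white pawns attack it. -/
def IsCover (w : List ℕ) (c : Cell) : Prop :=
  c.2.1 = w.length - 1 ∧ 2 * parentSlot w + 2 ≤ along w c ∧ across w c = 2 * slot w + 2

/-- The junction of `w`: the two cells attacked by the pawn of `w` that are not guards of its bishop.
They belong to the tunnel of the parent of `w`. -/
def IsJunction (w : List ℕ) (c : Cell) : Prop :=
  c.2.1 = w.length - 1 ∧ along w c = 2 * parentSlot w ∧
    (across w c = 2 * slot w ∨ across w c = 2 * slot w + 2)

theorem exists_isBishopHome (w : List ℕ) : ∃ c, IsBishopHome w c :=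
  ⟨frameCell w (parentSlot w - 2) w.length (slot w), by
    have := frameCell_spec w (parentSlot w - 2) w.length (slot w)
    unfold IsBishopHome; omega⟩

theorem exists_isPawnHome (w : List ℕ) : ∃ c, IsPawnHome w c :=
  ⟨frameCell w (parentSlot w - 1) w.length (slot w), by
    have := frameCell_spec w (parentSlot w - 1) w.length (slot w)
    unfold IsPawnHome; omega⟩

theorem isGuard_iff {w : List ℕ} {c : Cell} : IsGuard w c ↔
    (c.2.1 = w.length ∧
      ((along w c = 2 * parentSlot w - 6 ∧ across w c = 2 * slot w) ∨
        (along w c = 2 * parentSlot w - 4 ∧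
          (across w c = 2 * slot w + 2 ∨ across w c = 2 * slot w - 2)))) ∨
    (c.2.1 = w.length + 1 ∧
      (along w c = 2 * parentSlot w - 4 ∨ along w c = 2 * parentSlot w - 6) ∧
      (across w c = 2 * slot w ∨ across w c = 2 * slot w - 2)) ∨
    (c.2.1 = w.length - 1 ∧
      (along w c = 2 * parentSlot w - 4 ∨ along w c = 2 * parentSlot w - 2) ∧
      (across w c = 2 * slot w ∨ across w c = 2 * slot w + 2)) := by
  unfold IsGuard IsPawnHome
  constructor
  · rintro ⟨⟨b, hb, h⟩, hp⟩
    unfold IsBishopHome at hb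
    rw [isDiagonalStep_sub_iff w, upDiag_iff w, upDiag_iff w] at h
    rcases h with h | h | h
    · exact .inl ⟨by omega, by omega⟩
    · exact .inr (.inl ⟨by omega, by omega, by omega⟩)
    · exact .inr (.inr ⟨by omega, by omega, by omega⟩)
  · intro h
    obtain ⟨b, hb⟩ := exists_isBishopHome w
    refine ⟨⟨b, hb, ?_⟩, by omega⟩
    unfold IsBishopHome at hb
    rw [isDiagonalStep_sub_iff w, upDiag_iff w, upDiag_iff w]
    rcases h with h | h | h
    · exact .inl ⟨by omega, by omega⟩
    · exact .inr (.inl ⟨by omega, by omega, by omega⟩)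
    · exact .inr (.inr ⟨by omega, by omega, by omega⟩)

/-- All that the separation arguments need about guards, apart from a few exact cases. -/
theorem IsGuard.bounds {w : List ℕ} {c : Cell} (h : IsGuard w c) :
    w.length - 1 ≤ c.2.1 ∧ c.2.1 ≤ w.length + 1 ∧
    2 * parentSlot w - 6 ≤ along w c ∧ along w c ≤ 2 * parentSlot w - 2 ∧
    2 * slot w - 2 ≤ across w c ∧ across w c ≤ 2 * slot w + 2 := by
  rw [isGuard_iff] at h; omega

/-- The cells that hold black pieces because of the node `w`. -/
def IsBlackSite (w : List ℕ) (c : Cell) : Prop := IsBishopHome w c ∨ IsPawnHome w c ∨ IsGuard w c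

theorem IsBlackSite.bounds {w : List ℕ} {c : Cell} (h : IsBlackSite w c) :
    w.length - 1 ≤ c.2.1 ∧ c.2.1 ≤ w.length + 1 ∧
    2 * parentSlot w - 6 ≤ along w c ∧ along w c ≤ 2 * parentSlot w - 2 ∧
    2 * slot w - 2 ≤ across w c ∧ across w c ≤ 2 * slot w + 2 := by
  rcases h with h | h | h
  · unfold IsBishopHome at h; omega
  · unfold IsPawnHome at h; omega
  · exact h.bounds

theorem IsTunnel.unique {u s : List ℕ} {c : Cell} (hu : IsTunnel u c) (hs : IsTunnel s c) :
    u = s := by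
  unfold IsTunnel at hu hs
  rcases slot_separated u s with h | h
  · exact h
  rcases frame_eq_or_swap u s with ⟨hp, hf⟩ | ⟨hp, hf⟩ <;> have := hf c <;> omega

theorem IsBishopHome.unique {u s : List ℕ} {c : Cell} (hu : IsBishopHome u c)
    (hs : IsBishopHome s c) : u = s := by
  unfold IsBishopHome at hu hs
  rcases slot_separated u s with h | h
  · exact h
  rcases frame_eq_or_swap u s with ⟨hp, hf⟩ | ⟨hp, hf⟩ <;> have := hf c <;> omega

theorem IsPawnHome.unique {u s : List ℕ} {c : Cell} (hu : IsPawnHome u c) (hs : IsPawnHome s c) :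
    u = s := by
  unfold IsPawnHome at hu hs
  rcases slot_separated u s with h | h
  · exact h
  rcases frame_eq_or_swap u s with ⟨hp, hf⟩ | ⟨hp, hf⟩ <;> have := hf c <;> omega

theorem IsJunction.unique {u s : List ℕ} {c : Cell} (hu : IsJunction u c) (hs : IsJunction s c) :
    u = s := by
  unfold IsJunction at hu hs
  rcases slot_separated u s with h | h
  · exact h
  rcases frame_eq_or_swap u s with ⟨hp, hf⟩ | ⟨hp, hf⟩ <;> have := hf c <;> omega

theorem IsJunction.isTunnel {n : ℕ} {u : List ℕ} {c : Cell} (h : IsJunction (n :: u) c) :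
    IsTunnel u c := by
  unfold IsJunction at h
  unfold IsTunnel
  have h1 := parentSlot_lt (n :: u)
  have h2 := parentSlot_lt u
  simp only [parentSlot, List.length_cons] at h h1
  rcases frame_eq_or_swap (n :: u) u with ⟨hp, hf⟩ | ⟨hp, hf⟩ <;> have := hf c <;>
    simp only [List.length_cons] at hp <;> omega

/-- A node other than `w` has black pieces near the tunnel of `w` only if it is a child of `w`. -/
theorem IsTunnel.isBlackSite {s w : List ℕ} {c : Cell} (hs : IsTunnel s c) (hw : IsBlackSite w c) :
    IsPawnHome w c ∧ w = s := by
  have hb := hw.bounds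
  unfold IsTunnel at hs
  rcases frame_eq_or_swap w s with ⟨hp, hf⟩ | ⟨hp, hf⟩ <;> have hc := hf c
  · rcases slot_separated w s with h | h
    · subst h
      refine ⟨?_, rfl⟩
      rcases hw with hw | hw | hw
      · unfold IsBishopHome at hw; omega
      · exact hw
      · rw [isGuard_iff] at hw; omega
    · omega
  · exfalso
    rcases parentSlot_separated s w with ⟨n, rfl⟩ | h
    · simp only [parentSlot] at hb; omega
    · omega

theorem IsCover.not_isBlackSite {s w : List ℕ} {c : Cell} (hs : IsCover s c) :
    ¬ IsBlackSite w c := by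
  intro hw
  have hb := hw.bounds
  unfold IsCover at hs
  rcases frame_eq_or_swap w s with ⟨hp, hf⟩ | ⟨hp, hf⟩ <;> have hc := hf c
  · rcases slot_separated w s with h | h
    · subst h; omega
    · omega
  · rcases parentSlot_separated s w with ⟨n, rfl⟩ | h
    · simp only [parentSlot] at hb; omega
    · omega

/-- The white pawns that cover a tunnel attack no black piece in its original place. -/
theorem IsCover.not_isBlackSite_upDiag {s w : List ℕ} {a c : Cell} (hs : IsCover s a)
    (h : UpDiag a c) : ¬ IsBlackSite w c := by
  intro hw
  have hb := hw.bounds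
  unfold IsCover at hs
  rw [upDiag_iff w] at h
  rcases frame_eq_or_swap w s with ⟨hp, hf⟩ | ⟨hp, hf⟩ <;> have hc := hf a
  · rcases slot_separated w s with h' | h'
    · subst h'; omega
    · omega
  · rcases parentSlot_separated s w with ⟨n, rfl⟩ | h'
    · simp only [parentSlot, List.length_cons] at hb; omega
    · omega

/-- A white pawn on the junction of `s` attacks no black piece in its original place, except for
the pawn of `s`. -/
theorem IsJunction.isBlackSite_upDiag {s w : List ℕ} {a c : Cell} (hs : IsJunction s a)
    (h : UpDiag a c) (hw : IsBlackSite w c) : IsPawnHome w c ∧ w = s := by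
  have hb := hw.bounds
  unfold IsJunction at hs
  rw [upDiag_iff w] at h
  rcases frame_eq_or_swap w s with ⟨hp, hf⟩ | ⟨hp, hf⟩ <;> have hc := hf a
  · rcases slot_separated w s with h' | h'
    · subst h'
      refine ⟨?_, rfl⟩
      rcases hw with hw | hw | hw
      · unfold IsBishopHome at hw; omega
      · exact hw
      · rw [isGuard_iff] at hw; omega
    · omega
  · exfalso
    rcases parentSlot_separated s w with ⟨n, rfl⟩ | h'
    · have := parentSlot_lt s
      have := parentSlot_lt (n :: s)
      simp only [parentSlot] at hb this
      omega
    · omega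

theorem IsJunction.not_isBlackSite {s w : List ℕ} {c : Cell} (hs : IsJunction s c) :
    ¬ IsBlackSite w c := by
  intro hw
  cases s with
  | nil =>
    have hb := hw.bounds
    unfold IsJunction at hs
    simp only [parentSlot, List.length_nil] at hs
    have h0 : slot [] = 0 := by simp [slot]
    rcases frame_eq_or_swap w [] with ⟨hp, hf⟩ | ⟨hp, hf⟩ <;> have hc := hf c
    · rcases slot_separated w [] with h' | h'
      · subst h'; simp only [parentSlot] at hb; omega
      · have := slot_nonneg w; omega
    · have := slot_nonneg w; omega
  | cons n u =>
    obtain ⟨h, rfl⟩ := hs.isTunnel.isBlackSite hw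
    have := parentSlot_lt w
    have := parentSlot_lt (n :: w)
    unfold IsJunction at hs
    unfold IsPawnHome at h
    simp only [parentSlot, List.length_cons] at *
    rcases frame_eq_or_swap (n :: w) w with ⟨hp, hf⟩ | ⟨hp, hf⟩ <;> have hc := hf c <;>
      simp only [List.length_cons] at hp <;> omega

/-- The cells attacked by the pawn of `w` are guards and the junction of `w`. -/
theorem IsPawnHome.upDiag {w : List ℕ} {a c : Cell} (h : IsPawnHome w c) (ha : UpDiag a c) :
    IsGuard w a ∨ IsJunction w a := by
  rw [isGuard_iff]
  unfold IsPawnHome at h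
  unfold IsJunction
  rw [upDiag_iff w] at ha
  obtain ⟨hy, h1 | h1, h2⟩ := ha
  · exact .inl (.inr (.inr ⟨by omega, by omega, by omega⟩))
  · exact .inr ⟨by omega, by omega, by omega⟩

theorem IsJunction.upDiag_pawnHome {w : List ℕ} {a c : Cell} (ha : IsJunction w a)
    (h : IsPawnHome w c) : UpDiag a c := by
  unfold IsPawnHome at h
  unfold IsJunction at ha
  rw [upDiag_iff w]
  omega

theorem IsTunnel.evenCell {w : List ℕ} {c : Cell} (h : IsTunnel w c) : EvenCell c := by
  rw [evenCell_iff_across w]; unfold IsTunnel at h; omega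

theorem IsCover.evenCell {w : List ℕ} {c : Cell} (h : IsCover w c) : EvenCell c := by
  rw [evenCell_iff_across w]; unfold IsCover at h; omega

theorem IsJunction.evenCell {w : List ℕ} {c : Cell} (h : IsJunction w c) : EvenCell c := by
  rw [evenCell_iff_along w]; unfold IsJunction at h; omega

theorem IsBlackSite.evenCell {w : List ℕ} {c : Cell} (h : IsBlackSite w c) : EvenCell c := by
  rw [evenCell_iff_along w]
  rcases h with h | h | h
  · unfold IsBishopHome at h; omega
  · unfold IsPawnHome at h; omega
  · rw [isGuard_iff] at h; omega

/-! ### The frozen frame of the position and the mating net -/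

/-- A black pawn on its cell. -/
abbrev bPawn : Option Piece := some ⟨.black, .pawn⟩
/-- A black knight on its cell. -/
abbrev bKnight : Option Piece := some ⟨.black, .knight⟩
/-- A black bishop on its cell. -/
abbrev bBishop : Option Piece := some ⟨.black, .bishop⟩
/-- The black king on its cell. -/
abbrev bKing : Option Piece := some ⟨.black, .king⟩
/-- A white pawn on its cell. -/
abbrev wPawn : Option Piece := some ⟨.white, .pawn⟩
/-- A white bishop on its cell. -/
abbrev wBishop : Option Piece := some ⟨.white, .bishop⟩

/-- The cell of the black king, far below all tunnels. -/
abbrev kingCell : Cell := (0, -40, 0)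
/-- The cell of the only white bishop; the white pawn on `maskCell` stands between it and the king. -/
abbrev bishopCell : Cell := (2, -38, 0)
/-- The cell of the white pawn whose departure opens the mating line. -/
abbrev maskCell : Cell := (1, -39, 0)
/-- The cell of the black pawn that is always free to advance. -/
abbrev fatalCell : Cell := (0, -37, 0)
/-- The cell to which the pawn on `fatalCell` advances, exposed to the pawn on `maskCell`. -/
abbrev fatalTarget : Cell := (0, -38, 0)

/-- The features common to all positions of the game before black's fatal pawn advance. The odd cells
are filled with black bishops, which block each other for ever; hence knights on even cells are
immobile, and pawns on even cells cannot advance. On the low even cells there is only the mating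
net around the black king. -/
structure Frozen (B : Board) : Prop where
  odd : ∀ c, ¬ EvenCell c → c ≠ fatalCell → B c = bBishop
  fatal : B fatalCell = bPawn
  king : B kingCell = bKing
  bishop : B bishopCell = wBishop
  net : ∀ c, IsDiagonalStep (c - bishopCell) → B c = wPawn
  knight : ∀ c, IsDiagonalStep (c - kingCell) → c ≠ maskCell → B c = bKnight
  low : ∀ c, EvenCell c → c.2.1 < -5 → c ≠ kingCell → c ≠ bishopCell →
    ¬ IsDiagonalStep (c - bishopCell) → ¬ IsDiagonalStep (c - kingCell) → B c = none
  high : ∀ c, EvenCell c → -5 ≤ c.2.1 →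
    B c = none ∨ B c = wPawn ∨ B c = bPawn ∨ B c = bKnight ∨ B c = bBishop

/-- On the high levels bishops can move only horizontally. -/
def LevelBishops (B : Board) : Prop :=
  ∀ a, EvenCell a → -5 ≤ a.2.1 → B a = bBishop → ∀ d, IsDiagonalStep d → d.2.1 ≠ 0 →
    ∃ k, B (a + d) = some ⟨.black, k⟩

theorem Slides.first {B : Board} {d a b : Cell} (h : Slides B d a b) :
    b = a + d ∨ B (a + d) = none := by
  obtain ⟨n, hn, rfl, hk⟩ := h
  rcases hn.eq_or_lt with rfl | hn
  · left; rw [one_smul]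
  · right; simpa using hk 1 le_rfl hn

theorem Slides.exists_eq {B : Board} {d a b : Cell} (h : Slides B d a b) :
    ∃ n : ℤ, b.1 = a.1 + n * d.1 ∧ b.2.1 = a.2.1 + n * d.2.1 ∧ b.2.2 = a.2.2 + n * d.2.2 := by
  obtain ⟨n, hn, rfl, hk⟩ := h
  exact ⟨n, by simp, by simp, by simp⟩

theorem evenCell_add_iff {d a : Cell} (hd : IsDiagonalStep d) : EvenCell (a + d) ↔ EvenCell a := by
  rw [isDiagonalStep_iff] at hd
  unfold EvenCell
  simp only [Prod.fst_add, Prod.snd_add]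
  omega

theorem Slides.evenCell_iff {B : Board} {d a b : Cell} (hd : IsDiagonalStep d)
    (h : Slides B d a b) : EvenCell b ↔ EvenCell a := by
  obtain ⟨n, h1, h2, h3⟩ := h.exists_eq
  rw [isDiagonalStep_iff] at hd
  have he : (d.1 + d.2.1 + d.2.2) % 2 = 0 := by omega
  obtain ⟨m, hm⟩ : ∃ m, d.1 + d.2.1 + d.2.2 = 2 * m := ⟨(d.1 + d.2.1 + d.2.2) / 2, by omega⟩
  have : b.1 + b.2.1 + b.2.2 = a.1 + a.2.1 + a.2.2 + 2 * (n * m) := by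
    rw [h1, h2, h3]; linear_combination n * hm
  unfold EvenCell
  omega

theorem UpDiag.evenCell_iff {a b : Cell} (h : UpDiag a b) : EvenCell a ↔ EvenCell b := by
  unfold UpDiag at h; unfold EvenCell; omega

theorem IsKnightStep.evenCell {a b : Cell} (h : IsKnightStep (b - a)) (ha : EvenCell a) :
    ¬ EvenCell b := by
  have := h.odd
  simp only [Prod.fst_sub, Prod.snd_sub] at this
  unfold EvenCell at *
  omega

theorem isDiagonalStep_evenCell {a b : Cell} (h : IsDiagonalStep (b - a)) (ha : EvenCell a) :
    EvenCell b := by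
  have := (evenCell_add_iff (a := a) h).2 ha
  simpa using this

theorem not_inCheck_white {B : Board} (h : ∀ c, B c ≠ some ⟨.white, .king⟩) :
    ¬ InCheck B .white := by
  rintro ⟨k, -, -, hk, -⟩
  exact h k hk

/-- Conditions that hold both in frozen positions and after the fatal advance: the only white piece
apart from pawns is a walled-in bishop, and no pawn attacks the king. -/
theorem not_inCheck_black {B : Board} (hking : ∀ c, B c = bKing → c = kingCell)
    (hwhite : ∀ c k, B c = some ⟨.white, k⟩ → k = .pawn ∨ (c = bishopCell ∧ k = .bishop))
    (hpawn : ∀ c, UpDiag c kingCell → B c ≠ wPawn)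
    (hnet : ∀ c, IsDiagonalStep (c - bishopCell) → B c ≠ none) : ¬ InCheck B .black := by
  rintro ⟨k, a, ⟨c, kd⟩, hk, ha, hc, hatt⟩
  obtain rfl := hking k hk
  obtain rfl : c = .white := hc
  rcases hwhite a kd ha with rfl | ⟨rfl, rfl⟩
  · rw [pieceAttacks_white_pawn] at hatt
    exact hpawn a hatt ha
  · obtain ⟨d, hd, hs⟩ := hatt
    rcases hs.first with h | h
    · rw [isDiagonalStep_iff] at hd
      simp only [Prod.ext_iff, Prod.fst_add, Prod.snd_add] at h
      omega
    · exact hnet _ (by simpa using hd) h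

namespace Frozen

variable {B : Board} (hB : Frozen B)
include hB

/-- The contents of a cell. -/
theorem classify (c : Cell) :
    (¬ EvenCell c ∧ c ≠ fatalCell ∧ B c = bBishop) ∨ (c = fatalCell ∧ B c = bPawn) ∨
    (c = kingCell ∧ B c = bKing) ∨ (c = bishopCell ∧ B c = wBishop) ∨
    (IsDiagonalStep (c - bishopCell) ∧ B c = wPawn) ∨
    (IsDiagonalStep (c - kingCell) ∧ c ≠ maskCell ∧ B c = bKnight) ∨
    (EvenCell c ∧ c.2.1 < -5 ∧ B c = none) ∨
    (EvenCell c ∧ -5 ≤ c.2.1 ∧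
      (B c = none ∨ B c = wPawn ∨ B c = bPawn ∨ B c = bKnight ∨ B c = bBishop)) := by
  by_cases he : EvenCell c
  · by_cases hl : c.2.1 < -5
    · by_cases h1 : c = kingCell
      · exact .inr (.inr (.inl ⟨h1, h1 ▸ hB.king⟩))
      by_cases h2 : c = bishopCell
      · exact .inr (.inr (.inr (.inl ⟨h2, h2 ▸ hB.bishop⟩)))
      by_cases h3 : IsDiagonalStep (c - bishopCell)
      · exact .inr (.inr (.inr (.inr (.inl ⟨h3, hB.net c h3⟩))))
      by_cases h4 : IsDiagonalStep (c - kingCell)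
      · refine .inr (.inr (.inr (.inr (.inr (.inl ⟨h4, ?_, hB.knight c h4 ?_⟩)))))
        all_goals
          rintro rfl
          exact h3 (by rw [isDiagonalStep_iff]; simp)
      exact .inr (.inr (.inr (.inr (.inr (.inr (.inl ⟨he, hl, hB.low c he hl h1 h2 h3 h4⟩))))))
    · have hl' : -5 ≤ c.2.1 := by omega
      exact .inr (.inr (.inr (.inr (.inr (.inr (.inr ⟨he, hl', hB.high c he hl'⟩))))))
  · by_cases h1 : c = fatalCell
    · exact .inr (.inl ⟨h1, h1 ▸ hB.fatal⟩)
    · exact .inl ⟨he, h1, hB.odd c he h1⟩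

theorem odd_black {c : Cell} (hc : ¬ EvenCell c) : ∃ k, B c = some ⟨.black, k⟩ := by
  by_cases h : c = fatalCell
  · exact ⟨_, h ▸ hB.fatal⟩
  · exact ⟨_, hB.odd c hc h⟩

theorem eq_kingCell {c : Cell} (h : B c = bKing) : c = kingCell := by
  rcases hB.classify c with ⟨-, -, h'⟩ | ⟨-, h'⟩ | ⟨hc, -⟩ | ⟨-, h'⟩ | ⟨-, h'⟩ | ⟨-, -, h'⟩ |
    ⟨-, -, h'⟩ | ⟨-, -, h' | h' | h' | h' | h'⟩
  case inr.inr.inl => exact hc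
  all_goals rw [h] at h'; simp at h'

/-- White has one bishop and otherwise only pawns, in the net and on the high levels. -/
theorem white_kind {c : Cell} {k : Kind} (h : B c = some ⟨.white, k⟩) :
    (k = .pawn ∧ EvenCell c ∧ (IsDiagonalStep (c - bishopCell) ∨ -5 ≤ c.2.1)) ∨
      (c = bishopCell ∧ k = .bishop) := by
  rcases hB.classify c with ⟨-, -, h'⟩ | ⟨-, h'⟩ | ⟨-, h'⟩ | ⟨hc, h'⟩ | ⟨hc, h'⟩ | ⟨-, -, h'⟩ |
    ⟨-, -, h'⟩ | ⟨he, hc, h' | h' | h' | h' | h'⟩ <;> rw [h] at h' <;> simp at h'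
  · exact .inr ⟨hc, h'⟩
  · exact .inl ⟨h', isDiagonalStep_evenCell hc (by simp [EvenCell]), .inl hc⟩
  · exact .inl ⟨h', he, .inr hc⟩

theorem not_inCheck_white : ¬ InCheck B .white :=
  Chess3D.not_inCheck_white fun c h => by rcases hB.white_kind h with ⟨h, -⟩ | ⟨-, h⟩ <;> cases h

theorem not_wPawn_below_king {c : Cell} (h : UpDiag c kingCell) : B c ≠ wPawn := by
  have : B c = bKnight := by
    refine hB.knight c ?_ ?_
    · rw [isDiagonalStep_iff]
      unfold UpDiag at h
      simp only [Prod.fst_sub, Prod.snd_sub] at h ⊢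
      omega
    · rintro rfl
      unfold UpDiag at h
      simp at h
  rw [this]; simp

theorem not_inCheck_black : ¬ InCheck B .black := by
  refine Chess3D.not_inCheck_black (fun c => hB.eq_kingCell) ?_
    (fun c h => hB.not_wPawn_below_king h) (fun c h => by rw [hB.net c h]; simp)
  intro c k h
  rcases hB.white_kind h with ⟨h, -⟩ | h
  · exact .inl h
  · exact .inr h

/-- White can move nothing but the pawns on the high levels, and these only to capture. -/
theorem white_move {a b : Cell} (h : CanMove B .white a b) :
    EvenCell a ∧ -5 ≤ a.2.1 ∧ B a = wPawn ∧ UpDiag a b ∧ ∃ k, B b = some ⟨.black, k⟩ := by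
  obtain ⟨⟨c, k⟩, ha, rfl, hm⟩ := h
  rcases hB.white_kind ha with ⟨rfl, he, hc⟩ | ⟨rfl, rfl⟩
  · rcases hm with ⟨⟨c, k⟩, hb, rfl, hm⟩ | ⟨-, h, -⟩ | ⟨hb, -, rfl⟩
    · rw [pieceAttacks_white_pawn] at hm
      refine ⟨he, ?_, ha, hm, k, hb⟩
      rcases hc with hc | hc
      · exfalso
        -- The pawns of the net look away from the king and its knights.
        rw [isDiagonalStep_iff] at hc
        have hbe := (UpDiag.evenCell_iff hm).1 he
        unfold UpDiag at hm
        simp only [Prod.fst_sub, Prod.snd_sub] at hc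
        rcases hB.classify b with ⟨h, -, -⟩ | ⟨rfl, -⟩ | ⟨rfl, -⟩ | ⟨-, h⟩ | ⟨-, h⟩ | ⟨h, -, -⟩ |
          ⟨-, -, h⟩ | ⟨-, h, -⟩
        · exact h hbe
        · simp [EvenCell] at hbe
        · simp only at hm; omega
        · rw [hb] at h; simp [Color.other] at h
        · rw [hb] at h; simp [Color.other] at h
        · rw [isDiagonalStep_iff] at h
          simp only [Prod.fst_sub, Prod.snd_sub] at h
          omega
        · rw [hb] at h; simp at h
        · omega
      · exact hc
    · exact absurd rfl h
    · exfalso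
      obtain ⟨k, hk⟩ := hB.odd_black (c := a + forward .white) (by
        unfold EvenCell at *
        simp only [Prod.fst_add, Prod.snd_add, forward]
        omega)
      rw [hb] at hk; cases hk
  · exfalso
    have hs : ∃ d, IsDiagonalStep d ∧ Slides B d bishopCell b := by
      rcases hm with ⟨-, -, -, hm⟩ | ⟨-, -, hm⟩ | ⟨-, h, -⟩
      · exact hm
      · exact hm
      · cases h
    obtain ⟨d, hd, hs⟩ := hs
    have hn := hB.net (bishopCell + d) (by simpa using hd)
    rcases hs.first with rfl | h
    · rcases hm with ⟨Q, hQ, hc, -⟩ | ⟨h, -⟩ | ⟨h, -⟩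
      · rw [hn] at hQ
        obtain rfl := Option.some.inj hQ
        cases hc
      · rw [hn] at h; cases h
      · rw [hn] at h; cases h
    · rw [hn] at h; cases h

/-- Black can move only the fatal pawn, the king (by capturing the pawn next to it), and pawns and
bishops on the even cells of the high levels. -/
theorem black_move {a b : Cell} (h : CanMove B .black a b) :
    (a = fatalCell ∧ b = fatalTarget) ∨ (a = kingCell ∧ b = maskCell) ∨
    (EvenCell a ∧ -5 ≤ a.2.1 ∧ ((B a = bPawn ∧ UpDiag b a ∧ ∃ k, B b = some ⟨.white, k⟩) ∨
      (B a = bBishop ∧ (∀ k, B b ≠ some ⟨.black, k⟩) ∧ ∃ d, IsDiagonalStep d ∧ Slides B d a b))) := by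
  obtain ⟨⟨c, k⟩, ha, rfl, hm⟩ := h
  have hb : ∀ k, B b ≠ some ⟨.black, k⟩ := by
    intro k hk
    rcases hm with ⟨Q, hQ, hc, -⟩ | ⟨h, -⟩ | ⟨h, -⟩
    · rw [hk] at hQ
      obtain rfl := Option.some.inj hQ
      cases hc
    · rw [hk] at h; cases h
    · rw [hk] at h; cases h
  have hbe : EvenCell b := by
    by_contra h
    obtain ⟨k, hk⟩ := hB.odd_black h
    exact hb k hk
  have hatt : k ≠ .pawn → PieceAttacks B ⟨.black, k⟩ a b := by
    intro hk
    rcases hm with ⟨-, -, -, h⟩ | ⟨-, -, h⟩ | ⟨-, h, -⟩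
    · exact h
    · exact h
    · exact absurd h hk
  have hcap : EvenCell a → k = .pawn → UpDiag b a ∧ ∃ k, B b = some ⟨.white, k⟩ := by
    rintro he rfl
    rcases hm with ⟨⟨c, k⟩, hk, hc, hm⟩ | ⟨-, h, -⟩ | ⟨hk, -, rfl⟩
    · rw [pieceAttacks_black_pawn] at hm
      obtain rfl : c = .white := hc
      exact ⟨hm, k, hk⟩
    · exact absurd rfl h
    · exfalso
      unfold EvenCell at he hbe
      simp only [Prod.fst_add, Prod.snd_add, forward] at hbe
      omega
  rcases hB.classify a with ⟨ho, -, h'⟩ | ⟨rfl, h'⟩ | ⟨rfl, h'⟩ | ⟨-, h'⟩ | ⟨-, h'⟩ | ⟨hd, -, h'⟩ |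
    ⟨-, -, h'⟩ | ⟨he, hl, h' | h' | h' | h' | h'⟩ <;> rw [ha] at h' <;> simp at h' <;> subst h'
  · obtain ⟨d, hd, hs⟩ := hatt (by simp)
    exact absurd ((hs.evenCell_iff hd).1 hbe) ho
  · left
    rcases hm with ⟨-, -, -, hm⟩ | ⟨-, h, -⟩ | ⟨-, -, rfl⟩
    · rw [pieceAttacks_black_pawn] at hm
      have := (UpDiag.evenCell_iff hm).1 hbe
      simp [EvenCell] at this
    · exact absurd rfl h
    · exact ⟨rfl, rfl⟩
  · right; left
    refine ⟨rfl, ?_⟩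
    by_contra hne
    rcases hatt (by simp) with h | h
    · rw [isOrthogonalStep_iff] at h
      unfold EvenCell at hbe
      simp only [Prod.fst_sub, Prod.snd_sub] at h
      omega
    · exact hb _ (hB.knight b h hne)
  · exact absurd hbe (IsKnightStep.evenCell (hatt (by simp))
      (isDiagonalStep_evenCell hd (by simp [EvenCell])))
  · exact .inr (.inr ⟨he, hl, .inl ⟨ha, hcap he rfl⟩⟩)
  · exact absurd hbe (IsKnightStep.evenCell (hatt (by simp)) he)
  · exact .inr (.inr ⟨he, hl, .inr ⟨ha, hb, hatt (by simp)⟩⟩)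

/-- The capture of the masking pawn by the king is illegal. -/
theorem inCheck_of_king_takes : InCheck (movePiece B kingCell maskCell) .black := by
  refine ⟨maskCell, bishopCell, ⟨.white, .bishop⟩, ?_, ?_, rfl, (-1, -1, 0), ?_, 1, le_rfl, ?_, ?_⟩
  · rw [movePiece_target _ (by simp)]; exact hB.king
  · rw [movePiece_of_ne _ (by simp) (by simp)]; exact hB.bishop
  · simp [isDiagonalStep_iff]
  · simp
  · intro k h1 h2; omega

end Frozen

/-! ### Mate after the fatal advance -/

namespace Frozen

variable {B : Board} (hB : Frozen B)
include hB

theorem fatalTarget_empty : B fatalTarget = none :=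
  hB.low _ (by simp [EvenCell]) (by simp) (by simp) (by simp) (by simp [isDiagonalStep_iff])
    (by simp [isDiagonalStep_iff])

theorem mask : B maskCell = wPawn := hB.net _ (by simp [isDiagonalStep_iff])

theorem canMove_fatal : CanMove B .black fatalCell fatalTarget :=
  ⟨⟨.black, .pawn⟩, hB.fatal, rfl, .inr (.inr ⟨hB.fatalTarget_empty, rfl, by simp [forward]⟩)⟩

theorem fatal_not_inCheck_black : ¬ InCheck (movePiece B fatalCell fatalTarget) .black := by
  refine Chess3D.not_inCheck_black ?_ ?_ ?_ ?_
  · intro c hc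
    by_cases h1 : c = fatalCell
    · rw [h1, movePiece_source] at hc; cases hc
    by_cases h2 : c = fatalTarget
    · rw [h2, movePiece_target _ (by simp), hB.fatal] at hc; cases hc
    rw [movePiece_of_ne _ h1 h2] at hc
    exact hB.eq_kingCell hc
  · intro c k hc
    by_cases h1 : c = fatalCell
    · rw [h1, movePiece_source] at hc; cases hc
    by_cases h2 : c = fatalTarget
    · rw [h2, movePiece_target _ (by simp), hB.fatal] at hc; cases hc
    rw [movePiece_of_ne _ h1 h2] at hc
    rcases hB.white_kind hc with ⟨h, -⟩ | h
    · exact .inl h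
    · exact .inr h
  · intro c h
    rw [movePiece_of_ne]
    · exact hB.not_wPawn_below_king h
    all_goals
      rintro rfl
      unfold UpDiag at h
      simp at h
  · intro c h
    rw [movePiece_of_ne, hB.net c h]
    · simp
    all_goals
      rintro rfl
      rw [isDiagonalStep_iff] at h
      simp at h

theorem mateBoard_apply (c : Cell) :
    movePiece (movePiece B fatalCell fatalTarget) maskCell fatalTarget c =
      if c = maskCell then none else if c = fatalTarget then wPawn
        else if c = fatalCell then none else B c := by
  split_ifs with h1 h2 h3
  · rw [h1, movePiece_source]
  · rw [h2, movePiece_target _ (by simp), movePiece_of_ne _ (by simp) (by simp), hB.mask]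
  · rw [movePiece_of_ne _ h1 h2, h3, movePiece_source]
  · rw [movePiece_of_ne _ h1 h2, movePiece_of_ne _ h3 h2]

theorem mateBoard_not_inCheck_white :
    ¬ InCheck (movePiece (movePiece B fatalCell fatalTarget) maskCell fatalTarget) .white := by
  refine Chess3D.not_inCheck_white fun c hc => ?_
  rw [hB.mateBoard_apply] at hc
  split_ifs at hc
  · simp at hc
  · rcases hB.white_kind hc with ⟨h, -⟩ | ⟨-, h⟩ <;> cases h

/-- In the final position black cannot parry the check: the king has no other cell, and no black
piece reaches the mating line. -/
theorem mateBoard_black_move (hL : LevelBishops B) {a b : Cell}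
    (h : CanMove (movePiece (movePiece B fatalCell fatalTarget) maskCell fatalTarget) .black a b) :
    (a = kingCell ∧ b = maskCell) ∨
      (a ≠ kingCell ∧ a ≠ bishopCell ∧ b ≠ kingCell ∧ b ≠ maskCell ∧ b ≠ bishopCell) := by
  have app := hB.mateBoard_apply
  set B' := movePiece (movePiece B fatalCell fatalTarget) maskCell fatalTarget with hB'
  obtain ⟨⟨c, k⟩, ha, rfl, hm⟩ := h
  have hb : ∀ k, B' b ≠ some ⟨.black, k⟩ := by
    intro k hk
    rcases hm with ⟨Q, hQ, hc, -⟩ | ⟨h, -⟩ | ⟨h, -⟩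
    · rw [hk] at hQ
      obtain rfl := Option.some.inj hQ
      cases hc
    · rw [hk] at h; cases h
    · rw [hk] at h; cases h
  have hbk : b ≠ kingCell := by
    rintro rfl
    refine hb .king ?_
    rw [app]; simp [hB.king]
  -- The advance has vacated one odd cell, so that odd bishops may move, but only to that cell.
  have hodd : ¬ EvenCell b → b = fatalCell := by
    intro he
    by_contra hne
    obtain ⟨k, hk⟩ := hB.odd_black he
    refine hb k ?_
    rw [app, if_neg, if_neg, if_neg hne, hk] <;> rintro rfl <;> simp [EvenCell] at he
  have hatt : k ≠ .pawn → PieceAttacks B' ⟨.black, k⟩ a b := by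
    intro hk
    rcases hm with ⟨-, -, -, h⟩ | ⟨-, -, h⟩ | ⟨-, h, -⟩
    · exact h
    · exact h
    · exact absurd h hk
  have hpawn : k = .pawn → a.2.1 - 1 = b.2.1 := by
    rintro rfl
    rcases hm with ⟨-, -, -, hm⟩ | ⟨-, h, -⟩ | ⟨-, -, rfl⟩
    · rw [pieceAttacks_black_pawn] at hm
      unfold UpDiag at hm; omega
    · exact absurd rfl h
    · simp [forward]; ring
  -- Odd cells, and the high levels, are disjoint from the mating line.
  have far : ∀ x : Cell, (¬ EvenCell x ∨ -6 ≤ x.2.1) → x ≠ maskCell ∧ x ≠ bishopCell := by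
    intro x hx
    constructor <;>
    · rintro rfl
      simp [EvenCell] at hx
  have ha' := ha
  rw [app] at ha'
  split_ifs at ha' with h1 h2 h3
  · simp at ha'
  have fin : a ≠ kingCell → a ≠ bishopCell → (¬ EvenCell b ∨ -6 ≤ b.2.1) →
      (a = kingCell ∧ b = maskCell) ∨
      (a ≠ kingCell ∧ a ≠ bishopCell ∧ b ≠ kingCell ∧ b ≠ maskCell ∧ b ≠ bishopCell) :=
    fun h4 h5 h6 => .inr ⟨h4, h5, hbk, (far b h6).1, (far b h6).2⟩
  rcases hB.classify a with ⟨ho, -, h'⟩ | ⟨rfl, h'⟩ | ⟨rfl, h'⟩ | ⟨-, h'⟩ | ⟨-, h'⟩ | ⟨hd, -, h'⟩ |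
    ⟨-, -, h'⟩ | ⟨he, hl, h' | h' | h' | h' | h'⟩ <;> rw [ha'] at h' <;> simp at h' <;> subst h'
  · obtain ⟨d, hd, hs⟩ := hatt (by simp)
    refine fin ?_ ?_ (.inl fun hbe => ho ((hs.evenCell_iff hd).1 hbe)) <;>
    · rintro rfl
      simp [EvenCell] at ho
  · exact absurd rfl h3
  · left
    refine ⟨rfl, ?_⟩
    by_contra hne
    have hbf : b ≠ fatalCell := by
      rintro rfl
      rcases hatt (by simp) with h | h
      · rw [isOrthogonalStep_iff] at h; simp at h
      · rw [isDiagonalStep_iff] at h; simp at h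
    rcases hatt (by simp) with h | h
    · refine hbf (hodd ?_)
      rw [isOrthogonalStep_iff] at h
      unfold EvenCell
      simp only [Prod.fst_sub, Prod.snd_sub] at h
      omega
    · refine hb .knight ?_
      rw [app, if_neg hne, if_neg, if_neg hbf, hB.knight b h hne]
      rintro rfl
      rw [isDiagonalStep_iff] at h
      simp at h
  · have hae : EvenCell a := isDiagonalStep_evenCell hd (by simp [EvenCell])
    refine fin ?_ ?_ (.inl (IsKnightStep.evenCell (hatt (by simp)) hae)) <;>
    · rintro rfl
      rw [isDiagonalStep_iff] at hd
      simp at hd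
  all_goals
    have hka : a ≠ kingCell := by rintro rfl; simp at hl
    have hba : a ≠ bishopCell := by rintro rfl; simp at hl
  · exact fin hka hba (.inr (by have := hpawn rfl; omega))
  · exact fin hka hba (.inl (IsKnightStep.evenCell (hatt (by simp)) he))
  · refine fin hka hba (.inr ?_)
    obtain ⟨d, hd, hs⟩ := hatt (by simp)
    by_cases hd0 : d.2.1 = 0
    · obtain ⟨n, -, h2, -⟩ := hs.exists_eq
      rw [h2, hd0]; omega
    · exfalso
      obtain ⟨k, hk⟩ := hL a he hl ha' d hd hd0
      have hk' : B' (a + d) = some ⟨.black, k⟩ := by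
        rw [isDiagonalStep_iff] at hd
        rw [app, if_neg, if_neg, if_neg, hk] <;>
        · intro h
          simp only [Prod.ext_iff, Prod.fst_add, Prod.snd_add] at h
          omega
      rcases hs.first with rfl | h
      · exact hb k hk'
      · rw [hk'] at h; cases h

end Frozen

/-- The fatal advance of the black pawn allows mate in one. -/
theorem Frozen.hasValue_fatal {p q : Position} (hB : Frozen p.board) (hL : LevelBishops p.board)
    (ht : p.turn = .black) (hqt : q.turn = p.turn.other)
    (hq : q.board = movePiece p.board fatalCell fatalTarget) : HasValue q := by
  obtain rfl := Position.eq_move hqt hq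
  set r := (p.move fatalCell fatalTarget).move maskCell fatalTarget with hr
  have hrt : r.turn = .black := by simp [hr, Position.move, ht, Color.other]
  have hqt : (p.move fatalCell fatalTarget).turn = .white := by
    simp [Position.move, ht, Color.other]
  have hrb : r.board = movePiece (movePiece p.board fatalCell fatalTarget) maskCell fatalTarget := rfl
  have app := hB.mateBoard_apply
  have hcheck : InCheck r.board .black := by
    refine ⟨kingCell, bishopCell, ⟨.white, .bishop⟩, ?_, ?_, rfl, (-1, -1, 0), ?_, 2, by simp, ?_, ?_⟩
    · rw [hrb, app]; simp [hB.king]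
    · rw [hrb, app]; simp [hB.bishop]
    · simp [isDiagonalStep_iff]
    · simp
    · intro k h1 h2
      obtain rfl : k = 1 := by omega
      rw [hrb, app]; simp
  have hmate : r.Checkmated := by
    refine ⟨?_, by rw [hrt]; exact hcheck, ?_⟩
    · rw [Position.OpponentInCheck, hrt]
      exact hB.mateBoard_not_inCheck_white
    · rintro u ⟨-, -, ⟨a, b, hm, hu⟩, hn⟩
      rw [hrt] at hm hn
      apply hn
      rw [hu]
      rcases hB.mateBoard_black_move hL hm with ⟨rfl, rfl⟩ | ⟨h1, h2, h3, h4, h5⟩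
      · refine ⟨maskCell, bishopCell, ⟨.white, .bishop⟩, ?_, ?_, rfl, (-1, -1, 0), ?_, 1, le_rfl,
          ?_, ?_⟩
        · rw [movePiece_target _ (by simp), hrb, app]; simp [hB.king]
        · rw [movePiece_of_ne _ (by simp) (by simp), hrb, app]; simp [hB.bishop]
        · simp [isDiagonalStep_iff]
        · simp
        · intro k h1 h2; omega
      · refine ⟨kingCell, bishopCell, ⟨.white, .bishop⟩, ?_, ?_, rfl, (-1, -1, 0), ?_, 2, by simp,
          ?_, ?_⟩
        · rw [movePiece_of_ne _ h1.symm h3.symm, hrb, app]; simp [hB.king]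
        · rw [movePiece_of_ne _ h2.symm h5.symm, hrb, app]; simp [hB.bishop]
        · simp [isDiagonalStep_iff]
        · simp
        · intro k h1 h2
          obtain rfl : k = 1 := by omega
          by_cases ha : maskCell = a
          · subst ha
            simp [movePiece_source]
          · have : movePiece r.board a b maskCell = none := by
              rw [movePiece_of_ne _ ha h4.symm, hrb, movePiece_source]
            simpa using this
  refine .of_white hqt (q := r) ⟨?_, rfl, ⟨maskCell, fatalTarget, ?_, rfl⟩, ?_⟩
    ⟨0, .won r 0 (.inl ⟨hrt, hmate⟩)⟩
  · rw [Position.OpponentInCheck, hqt]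
    exact hB.fatal_not_inCheck_black
  · rw [hqt]
    refine ⟨⟨.white, .pawn⟩, ?_, rfl, .inl ⟨⟨.black, .pawn⟩, ?_, rfl, ?_⟩⟩
    · change movePiece p.board fatalCell fatalTarget maskCell = _
      rw [movePiece_of_ne _ (by simp) (by simp)]; exact hB.mask
    · change movePiece p.board fatalCell fatalTarget fatalTarget = _
      rw [movePiece_target _ (by simp)]; exact hB.fatal
    · rw [pieceAttacks_white_pawn]; simp [UpDiag]
  · rw [hqt]
    exact hB.mateBoard_not_inCheck_white

theorem Frozen.legalMove_fatal {p : Position} (hB : Frozen p.board) (ht : p.turn = .black) :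
    LegalMove p (p.move fatalCell fatalTarget) := by
  refine ⟨?_, rfl, ⟨fatalCell, fatalTarget, ?_, rfl⟩, ?_⟩
  · rw [Position.OpponentInCheck, ht]; exact hB.not_inCheck_white
  · rw [ht]; exact hB.canMove_fatal
  · rw [ht]; exact hB.fatal_not_inCheck_black

/-- To see that white wins from a frozen position with black to move, only the moves of black on the
high levels have to be answered. -/
theorem Frozen.hasValue {p : Position} (hB : Frozen p.board) (hL : LevelBishops p.board)
    (ht : p.turn = .black)
    (h : ∀ a b, EvenCell a → -5 ≤ a.2.1 →
      ((p.board a = bPawn ∧ UpDiag b a ∧ ∃ k, p.board b = some ⟨.white, k⟩) ∨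
        (p.board a = bBishop ∧ (∀ k, p.board b ≠ some ⟨.black, k⟩) ∧
          ∃ d, IsDiagonalStep d ∧ Slides p.board d a b)) →
      LegalMove p (p.move a b) → HasValue (p.move a b)) : HasValue p := by
  refine .of_black ht ⟨_, hB.legalMove_fatal ht⟩ fun q hq => ?_
  obtain ⟨h1, hqt, ⟨a, b, hm, hqb⟩, hn⟩ := id hq
  rw [ht] at hm hn
  rcases hB.black_move hm with ⟨rfl, rfl⟩ | ⟨rfl, rfl⟩ | ⟨he, hl, hab⟩
  · exact hB.hasValue_fatal hL ht hqt hqb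
  · rw [hqb] at hn
    exact absurd hB.inCheck_of_king_takes hn
  · obtain rfl := Position.eq_move hqt hqb
    exact h a b he hl hab hq

/-! ### The starting board of a tree -/

theorem IsPawnHome.isTunnel {w : List ℕ} {c : Cell} (h : IsPawnHome w c) : IsTunnel w c :=
  ⟨h.1, h.2.1.ge, h.2.2⟩

theorem IsPawnHome.not_isBishopHome {s w : List ℕ} {c : Cell} (hs : IsPawnHome s c) :
    ¬ IsBishopHome w c := by
  intro hw
  have := (hs.isTunnel.isBlackSite (.inl hw)).1
  unfold IsPawnHome at this
  unfold IsBishopHome at hw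
  omega

theorem IsPawnHome.not_isGuard {s w : List ℕ} {c : Cell} (hs : IsPawnHome s c) :
    ¬ IsGuard w c := fun hw => hw.2 (hs.isTunnel.isBlackSite (.inr (.inr hw))).1

theorem IsTunnel.not_isGuard {s w : List ℕ} {c : Cell} (hs : IsTunnel s c) :
    ¬ IsGuard w c := fun hw => hw.2 (hs.isBlackSite (.inr (.inr hw))).1

theorem IsTunnel.not_isBishopHome {s w : List ℕ} {c : Cell} (hs : IsTunnel s c) :
    ¬ IsBishopHome w c := fun hw => by
  have := (hs.isBlackSite (.inl hw)).1
  exact this.not_isBishopHome hw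

theorem IsBishopHome.not_isGuard {s w : List ℕ} {c : Cell} (hs : IsBishopHome s c) :
    ¬ IsGuard w c := by
  intro hw
  have hb := hw.bounds
  rw [isGuard_iff] at hw
  unfold IsBishopHome at hs
  rcases frame_eq_or_swap w s with ⟨hp, hf⟩ | ⟨hp, hf⟩ <;> have hc := hf c
  · rcases slot_separated w s with h | h
    · subst h; omega
    · omega
  · -- Each of the two nodes would have to be the parent of the other.
    rcases parentSlot_separated s w with ⟨n, rfl⟩ | h
    · rcases parentSlot_separated (n :: s) s with ⟨m, h⟩ | h
      · have := congrArg List.length h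
        simp only [List.length_cons] at this
        omega
      · omega
    · omega

theorem IsBlackSite.high {w : List ℕ} {c : Cell} (h : IsBlackSite w c) : -5 ≤ c.2.1 := by
  have := h.bounds; omega

theorem IsTunnel.high {w : List ℕ} {c : Cell} (h : IsTunnel w c) : -5 ≤ c.2.1 := by
  unfold IsTunnel at h; omega

theorem IsCover.high {w : List ℕ} {c : Cell} (h : IsCover w c) : -5 ≤ c.2.1 := by
  unfold IsCover at h; omega

theorem IsJunction.high {w : List ℕ} {c : Cell} (h : IsJunction w c) : -5 ≤ c.2.1 := by
  unfold IsJunction at h; omega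

open Classical in
/-- The starting board that belongs to a set `T` of nodes. The clauses are in order of precedence:
in particular a white pawn that would stand in a tunnel is left out. The pawn home of the root is
empty and its junction occupied by white, so that the bishop of the root is free to move. -/
noncomputable def startBoard (T : Set (List ℕ)) : Board := fun c =>
  if ¬ EvenCell c then (if c = fatalCell then bPawn else bBishop)
  else if c.2.1 < -5 then
    (if c = kingCell then bKing
    else if c = bishopCell then wBishop
    else if IsDiagonalStep (c - bishopCell) then wPawn
    else if IsDiagonalStep (c - kingCell) then bKnight
    else none)
  else if ∃ w ∈ T, IsBishopHome w c then bBishop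
  else if ∃ w ∈ T, w ≠ [] ∧ IsPawnHome w c then bPawn
  else if ∃ w ∈ T, IsGuard w c then bKnight
  else if ∃ w ∈ T, IsTunnel w c then none
  else if (∃ w ∈ T, IsCover w c) ∨ IsJunction [] c then wPawn
  else none

section

variable {T : Set (List ℕ)}

theorem startBoard_high {c : Cell} (he : EvenCell c) (hl : -5 ≤ c.2.1) :
    (startBoard T c = bBishop ∧ ∃ w ∈ T, IsBishopHome w c) ∨
    (startBoard T c = bPawn ∧ ∃ w ∈ T, w ≠ [] ∧ IsPawnHome w c) ∨
    (startBoard T c = bKnight ∧ ∃ w ∈ T, IsGuard w c) ∨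
    (startBoard T c = wPawn ∧ (∀ w ∈ T, ¬ IsTunnel w c) ∧
      ((∃ w ∈ T, IsCover w c) ∨ IsJunction [] c)) ∨
    startBoard T c = none := by
  unfold startBoard
  rw [if_neg (not_not.2 he), if_neg (not_lt.2 hl)]
  split_ifs with h1 h2 h3 h4 h5
  · exact .inl ⟨rfl, h1⟩
  · exact .inr (.inl ⟨rfl, h2⟩)
  · exact .inr (.inr (.inl ⟨rfl, h3⟩))
  · exact .inr (.inr (.inr (.inr rfl)))
  · exact .inr (.inr (.inr (.inl ⟨rfl, fun w hw ht => h4 ⟨w, hw, ht⟩, h5⟩)))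
  · exact .inr (.inr (.inr (.inr rfl)))

theorem startBoard_bishopHome {w : List ℕ} (hw : w ∈ T) {c : Cell} (h : IsBishopHome w c) :
    startBoard T c = bBishop := by
  unfold startBoard
  have hs : IsBlackSite w c := .inl h
  rw [if_neg (not_not.2 hs.evenCell), if_neg (not_lt.2 hs.high), if_pos ⟨w, hw, h⟩]

theorem startBoard_pawnHome {w : List ℕ} (hw : w ∈ T) (h0 : w ≠ []) {c : Cell}
    (h : IsPawnHome w c) : startBoard T c = bPawn := by
  unfold startBoard
  have hs : IsBlackSite w c := .inr (.inl h)
  rw [if_neg (not_not.2 hs.evenCell), if_neg (not_lt.2 hs.high),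
    if_neg (fun ⟨_, _, h'⟩ => h.not_isBishopHome h'), if_pos ⟨w, hw, h0, h⟩]

theorem startBoard_guard {w : List ℕ} (hw : w ∈ T) {c : Cell} (h : IsGuard w c) :
    startBoard T c = bKnight := by
  unfold startBoard
  have hs : IsBlackSite w c := .inr (.inr h)
  rw [if_neg (not_not.2 hs.evenCell), if_neg (not_lt.2 hs.high),
    if_neg (fun ⟨_, _, h'⟩ => h'.not_isGuard h), if_neg (fun ⟨_, _, _, h'⟩ => h'.not_isGuard h),
    if_pos ⟨w, hw, h⟩]

theorem startBoard_tunnel {w : List ℕ} (hw : w ∈ T) {c : Cell} (h : IsTunnel w c)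
    (h0 : w = [] ∨ ¬ IsPawnHome w c) : startBoard T c = none := by
  unfold startBoard
  rw [if_neg (not_not.2 h.evenCell), if_neg (not_lt.2 h.high),
    if_neg (fun ⟨_, _, h'⟩ => h.not_isBishopHome h'), if_neg, if_neg
    (fun ⟨_, _, h'⟩ => h.not_isGuard h'), if_pos ⟨w, hw, h⟩]
  rintro ⟨v, -, hv, hp⟩
  obtain ⟨-, rfl⟩ := h.isBlackSite (.inr (.inl hp))
  rcases h0 with h0 | h0
  · exact hv h0
  · exact h0 hp

theorem startBoard_cover {w : List ℕ} (hw : w ∈ T) {c : Cell} (h : IsCover w c)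
    (h0 : ∀ v ∈ T, ¬ IsTunnel v c) : startBoard T c = wPawn := by
  unfold startBoard
  rw [if_neg (not_not.2 h.evenCell), if_neg (not_lt.2 h.high),
    if_neg (fun ⟨_, _, h'⟩ => h.not_isBlackSite (.inl h')),
    if_neg (fun ⟨_, _, _, h'⟩ => h.not_isBlackSite (.inr (.inl h'))),
    if_neg (fun ⟨_, _, h'⟩ => h.not_isBlackSite (.inr (.inr h'))),
    if_neg (fun ⟨v, hv, h'⟩ => h0 v hv h'), if_pos (.inl ⟨w, hw, h⟩)]

theorem startBoard_junction {c : Cell} (h : IsJunction [] c) : startBoard T c = wPawn := by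
  unfold startBoard
  rw [if_neg (not_not.2 h.evenCell), if_neg (not_lt.2 h.high),
    if_neg (fun ⟨_, _, h'⟩ => h.not_isBlackSite (.inl h')),
    if_neg (fun ⟨_, _, _, h'⟩ => h.not_isBlackSite (.inr (.inl h'))),
    if_neg (fun ⟨_, _, h'⟩ => h.not_isBlackSite (.inr (.inr h'))), if_neg, if_pos (.inr h)]
  rintro ⟨v, -, h'⟩
  have h1 := h.1
  have h2 := h'.1
  simp only [List.length_nil] at h1
  omega

theorem frozen_startBoard : Frozen (startBoard T) where
  odd c he hc := by unfold startBoard; rw [if_pos he, if_neg hc]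
  fatal := by unfold startBoard; rw [if_pos (by simp [EvenCell]), if_pos rfl]
  king := by unfold startBoard; simp [EvenCell]
  bishop := by unfold startBoard; simp [EvenCell]
  net c h := by
    have he : EvenCell c := isDiagonalStep_evenCell h (by simp [EvenCell])
    unfold startBoard
    have h' := h
    rw [isDiagonalStep_iff] at h'
    simp only [Prod.fst_sub, Prod.snd_sub] at h'
    rw [if_neg (not_not.2 he), if_pos (by omega), if_neg, if_neg, if_pos h] <;>
    · rintro rfl
      simp at h'
  knight c h hm := by
    have he : EvenCell c := isDiagonalStep_evenCell h (by simp [EvenCell])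
    unfold startBoard
    have h' := h
    rw [isDiagonalStep_iff] at h'
    simp only [Prod.fst_sub, Prod.snd_sub] at h'
    rw [if_neg (not_not.2 he), if_pos (by omega), if_neg, if_neg, if_neg, if_pos h]
    · intro hd
      rw [isDiagonalStep_iff] at hd
      simp only [Prod.fst_sub, Prod.snd_sub] at hd
      exact hm (by ext <;> simp only <;> omega)
    all_goals
      rintro rfl
      simp at h'
  low c he hl h1 h2 h3 h4 := by
    unfold startBoard
    rw [if_neg (not_not.2 he), if_pos hl, if_neg h1, if_neg h2, if_neg h3, if_neg h4]
  high c he hl := by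
    rcases startBoard_high (T := T) he hl with h | h | h | h | h <;> simp [h]

end

/-- Moving a piece within the high even cells does not affect the frozen frame. -/
theorem Frozen.movePiece {B : Board} (hB : Frozen B) {a b : Cell} (ha : EvenCell a)
    (hal : -5 ≤ a.2.1) (hb : EvenCell b) (hbl : -5 ≤ b.2.1) : Frozen (movePiece B a b) := by
  have key : ∀ c, (¬ EvenCell c ∨ c.2.1 < -5) → Chess3D.movePiece B a b c = B c := by
    intro c hc
    refine movePiece_of_ne _ ?_ ?_ <;>
    · rintro rfl
      rcases hc with hc | hc
      · exact hc ‹_›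
      · omega
  refine ⟨fun c hc h => by rw [key c (.inl hc), hB.odd c hc h], ?_, ?_, ?_, fun c h => ?_,
    fun c h hm => ?_, fun c hc hl => ?_, fun c hc hl => ?_⟩
  · rw [key _ (.inl (by simp [EvenCell])), hB.fatal]
  · rw [key _ (.inr (by simp)), hB.king]
  · rw [key _ (.inr (by simp)), hB.bishop]
  · have h' := h
    rw [isDiagonalStep_iff] at h'
    simp only [Prod.fst_sub, Prod.snd_sub] at h'
    rw [key _ (.inr (by omega)), hB.net c h]
  · have h' := h
    rw [isDiagonalStep_iff] at h'
    simp only [Prod.fst_sub, Prod.snd_sub] at h'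
    rw [key _ (.inr (by omega)), hB.knight c h hm]
  · rw [key _ (.inr hl)]; exact hB.low c hc hl
  · by_cases h1 : c = a
    · rw [h1, movePiece_source]; exact .inl rfl
    by_cases h2 : c = b
    · subst h2; rw [movePiece_target _ h1]; exact hB.high a ha hal
    · rw [movePiece_of_ne _ h1 h2]; exact hB.high c hc hl

/-! ### The positions reached at a node -/

/-- The boards that arise with black to move when the play has reached the node `s`: of the nodes
below the root on the way to `s`, the bishop of the parent, the pawn of the node, and at most some
white pawns covering the tunnel of the parent have disappeared, and a white pawn has arrived on the
junction. The bishop of `s` is free to move. -/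
structure AtNode (T : Set (List ℕ)) (s : List ℕ) (B : Board) : Prop where
  cell : ∀ c, B c = startBoard T c ∨ ∃ n u, (n :: u) <:+ s ∧
    ((B c = none ∧ (IsBishopHome u c ∨ IsPawnHome (n :: u) c ∨ IsCover u c)) ∨
      (B c = wPawn ∧ IsJunction (n :: u) c))
  home : ∀ n u, (n :: u) <:+ s → ∀ c, IsBishopHome u c → B c = none
  pawn : ∀ n u, (n :: u) <:+ s → ∀ c, IsPawnHome (n :: u) c → B c = none
  junction : ∃ c, IsJunction s c ∧ B c = wPawn

theorem atNode_nil (T : Set (List ℕ)) : AtNode T [] (startBoard T) where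
  cell _ := .inl rfl
  home n u h := by simp at h
  pawn n u h := by simp at h
  junction := by
    have := frameCell_spec [] (parentSlot []) (-1) (slot [])
    have h : IsJunction [] (frameCell [] (parentSlot []) (-1) (slot [])) := by
      unfold IsJunction; simp only [List.length_nil]; omega
    exact ⟨_, h, startBoard_junction h⟩

namespace AtNode

variable {T : Set (List ℕ)} {s : List ℕ} {B : Board}

theorem cell_high (h : AtNode T s B) (c : Cell) : B c = startBoard T c ∨
    (EvenCell c ∧ -5 ≤ c.2.1 ∧ (B c = none ∨ B c = wPawn)) := by
  rcases h.cell c with h | ⟨n, u, -, ⟨h, hc | hc | hc⟩ | ⟨h, hc⟩⟩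
  · exact .inl h
  · have hs : IsBlackSite u c := .inl hc
    exact .inr ⟨hs.evenCell, hs.high, .inl h⟩
  · have hs : IsBlackSite (n :: u) c := .inr (.inl hc)
    exact .inr ⟨hs.evenCell, hs.high, .inl h⟩
  · exact .inr ⟨hc.evenCell, hc.high, .inl h⟩
  · exact .inr ⟨hc.evenCell, hc.high, .inr h⟩

theorem frozen (h : AtNode T s B) : Frozen B := by
  have F := frozen_startBoard (T := T)
  have key : ∀ c, (¬ EvenCell c ∨ c.2.1 < -5) → B c = startBoard T c := by
    intro c hc
    rcases h.cell_high c with h | ⟨h1, h2, -⟩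
    · exact h
    · rcases hc with hc | hc
      · exact absurd h1 hc
      · omega
  refine ⟨fun c hc h => by rw [key c (.inl hc), F.odd c hc h], ?_, ?_, ?_, fun c h => ?_,
    fun c h hm => ?_, fun c hc hl => ?_, fun c hc hl => ?_⟩
  · rw [key _ (.inl (by simp [EvenCell])), F.fatal]
  · rw [key _ (.inr (by simp)), F.king]
  · rw [key _ (.inr (by simp)), F.bishop]
  · have h' := h
    rw [isDiagonalStep_iff] at h'
    simp only [Prod.fst_sub, Prod.snd_sub] at h'
    rw [key _ (.inr (by omega)), F.net c h]
  · have h' := h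
    rw [isDiagonalStep_iff] at h'
    simp only [Prod.fst_sub, Prod.snd_sub] at h'
    rw [key _ (.inr (by omega)), F.knight c h hm]
  · rw [key _ (.inr hl)]; exact F.low c hc hl
  · rcases h.cell_high c with h | ⟨-, -, h | h⟩
    · rw [h]; exact F.high c hc hl
    · exact .inl h
    · exact .inr (.inl h)

theorem not_suffix_cons {n : ℕ} {s : List ℕ} : ¬ (n :: s) <:+ s := fun h => by
  have := h.length_le
  simp at this

/-- A node of a way is its end or has a successor on the way. -/
theorem suffix_cases {w s : List ℕ} (h : w <:+ s) : w = s ∨ ∃ n, (n :: w) <:+ s := by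
  induction s with
  | nil => exact .inl (List.suffix_nil.1 h)
  | cons m s ih =>
    rcases List.suffix_cons_iff.1 h with h | h
    · exact .inl h
    · rcases ih h with rfl | ⟨n, hn⟩
      · exact .inr ⟨m, List.suffix_rfl⟩
      · exact .inr ⟨n, hn.trans (List.suffix_cons _ _)⟩

/-- The black pieces on the high even cells stand in their original places. -/
theorem black_cases (h : AtNode T s B) {c : Cell} (he : EvenCell c) (hl : -5 ≤ c.2.1) {k : Kind}
    (hc : B c = some ⟨.black, k⟩) :
    (k = .bishop ∧ ∃ w ∈ T, IsBishopHome w c ∧ ∀ n, ¬ (n :: w) <:+ s) ∨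
    (k = .pawn ∧ ∃ w ∈ T, w ≠ [] ∧ IsPawnHome w c ∧ ¬ w <:+ s) ∨
    (k = .knight ∧ ∃ w ∈ T, IsGuard w c) := by
  rcases h.cell_high c with h' | ⟨-, -, h' | h'⟩
  · have hc' := hc
    rw [h'] at hc
    rcases startBoard_high (T := T) he hl with ⟨e, w, hw, hb⟩ | ⟨e, w, hw, h0, hb⟩ | ⟨e, w, hw, hb⟩ |
      ⟨e, -⟩ | e <;> rw [hc] at e <;> simp at e
    · refine .inl ⟨e, w, hw, hb, fun n hn => ?_⟩
      rw [h.home n w hn c hb] at hc'; cases hc'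
    · refine .inr (.inl ⟨e, w, hw, h0, hb, fun hn => ?_⟩)
      cases w with
      | nil => exact h0 rfl
      | cons n u => rw [h.pawn n u hn c hb] at hc'; cases hc'
    · exact .inr (.inr ⟨e, w, hw, hb⟩)
  · rw [hc] at h'; cases h'
  · rw [hc] at h'; simp at h'

theorem white_cases (h : AtNode T s B) (hs : ∀ w, w <:+ s → w ∈ T) {c : Cell} (he : EvenCell c)
    (hl : -5 ≤ c.2.1) (hc : B c = wPawn) :
    ((∀ w ∈ T, ¬ IsTunnel w c) ∧ ∃ w ∈ T, IsCover w c) ∨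
      (∃ w ∈ T, w <:+ s ∧ IsJunction w c) := by
  rcases h.cell c with h' | ⟨n, u, hu, ⟨h', -⟩ | ⟨h', hj⟩⟩
  · rw [h'] at hc
    rcases startBoard_high (T := T) he hl with ⟨e, -⟩ | ⟨e, -⟩ | ⟨e, -⟩ |
      ⟨e, ht, hw | hj⟩ | e <;> try (rw [hc] at e; simp at e)
    · exact .inl ⟨ht, hw⟩
    · exact .inr ⟨[], hs _ (List.nil_suffix), List.nil_suffix, hj⟩
  · rw [hc] at h'; cases h'
  · exact .inr ⟨_, hs _ hu, hu, hj⟩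

theorem bishopHome (h : AtNode T s B) (hs : s ∈ T) {c : Cell} (hc : IsBishopHome s c) :
    B c = bBishop := by
  rcases h.cell c with h' | ⟨n, u, hu, ⟨-, h' | h' | h'⟩ | ⟨-, h'⟩⟩
  · rw [h', startBoard_bishopHome hs hc]
  · obtain rfl := h'.unique hc
    exact absurd hu not_suffix_cons
  · exact absurd hc h'.not_isBishopHome
  · exact absurd (.inl hc) h'.not_isBlackSite
  · exact absurd (.inl hc) h'.not_isBlackSite

theorem guard (h : AtNode T s B) {w : List ℕ} (hw : w ∈ T) {c : Cell} (hc : IsGuard w c) :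
    B c = bKnight := by
  rcases h.cell c with h' | ⟨n, u, hu, ⟨-, h' | h' | h'⟩ | ⟨-, h'⟩⟩
  · rw [h', startBoard_guard hw hc]
  · exact absurd hc h'.not_isGuard
  · exact absurd hc h'.not_isGuard
  · exact absurd (.inr (.inr hc)) h'.not_isBlackSite
  · exact absurd (.inr (.inr hc)) h'.not_isBlackSite

theorem pawnHome (h : AtNode T s B) {w : List ℕ} (hw : w ∈ T) (hs : ¬ w <:+ s) {c : Cell}
    (hc : IsPawnHome w c) : B c = bPawn := by
  rcases h.cell c with h' | ⟨n, u, hu, ⟨-, h' | h' | h'⟩ | ⟨-, h'⟩⟩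
  · rw [h', startBoard_pawnHome hw _ hc]
    rintro rfl
    exact hs List.nil_suffix
  · exact absurd h' hc.not_isBishopHome
  · obtain rfl := h'.unique hc
    exact absurd hu hs
  · exact absurd (.inr (.inl hc)) h'.not_isBlackSite
  · exact absurd (.inr (.inl hc)) h'.not_isBlackSite

theorem tunnel (h : AtNode T s B) (hs : s ∈ T) {c : Cell} (hc : IsTunnel s c) : B c = none := by
  by_cases hp : IsPawnHome s c ∧ s ≠ []
  · obtain ⟨hp, h0⟩ := hp
    cases s with
    | nil => exact absurd rfl h0
    | cons n u => exact h.pawn n u List.suffix_rfl c hp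
  rcases h.cell c with h' | ⟨n, u, hu, ⟨h', -⟩ | ⟨-, h'⟩⟩
  · rw [h', startBoard_tunnel hs hc]
    by_cases h0 : s = []
    · exact .inl h0
    · exact .inr fun h => hp ⟨h, h0⟩
  · exact h'
  · obtain rfl := h'.isTunnel.unique hc
    exact absurd hu not_suffix_cons

theorem cover (h : AtNode T s B) (hs : s ∈ T) {c : Cell} (hc : IsCover s c)
    (ht : ∀ w ∈ T, ¬ IsTunnel w c) (hT : ∀ w, w <:+ s → w ∈ T) : B c = wPawn := by
  rcases h.cell c with h' | ⟨n, u, hu, ⟨-, h' | h' | h'⟩ | ⟨-, h'⟩⟩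
  · rw [h', startBoard_cover hs hc ht]
  · exact absurd (.inl h') hc.not_isBlackSite
  · exact absurd (.inr (.inl h')) hc.not_isBlackSite
  · obtain rfl : u = s := by
      unfold IsCover at h' hc
      rcases slot_separated u s with e | e
      · exact e
      rcases frame_eq_or_swap u s with ⟨hp, hf⟩ | ⟨hp, hf⟩ <;> have := hf c <;> omega
    exact absurd hu not_suffix_cons
  · exact absurd h'.isTunnel (ht u (hT u ((List.suffix_cons _ _).trans hu)))

/-- White pawns attack no black pieces. -/
theorem not_hanging (h : AtNode T s B) (hs : ∀ w, w <:+ s → w ∈ T) {a b : Cell} {k : Kind}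
    (he : EvenCell a) (hl : -5 ≤ a.2.1) (ha : B a = wPawn) (hb : B b = some ⟨.black, k⟩)
    (hab : UpDiag a b) : False := by
  have hbl : -5 ≤ b.2.1 := by unfold UpDiag at hab; omega
  have hc := h.black_cases (hab.evenCell_iff.1 he) hbl hb
  obtain ⟨w, hw, hp⟩ : ∃ w, IsBlackSite w b ∧ (IsPawnHome w b → ¬ w <:+ s) := by
    rcases hc with ⟨-, w, -, hw, -⟩ | ⟨-, w, -, -, hw, hn⟩ | ⟨-, w, -, hw⟩
    · exact ⟨w, .inl hw, fun h => absurd hw h.not_isBishopHome⟩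
    · exact ⟨w, .inr (.inl hw), fun _ => hn⟩
    · exact ⟨w, .inr (.inr hw), fun h => absurd hw h.not_isGuard⟩
  rcases h.white_cases hs he hl ha with ⟨-, v, -, hv⟩ | ⟨v, -, hvs, hv⟩
  · exact hv.not_isBlackSite_upDiag hab hw
  · obtain ⟨h1, rfl⟩ := hv.isBlackSite_upDiag hab hw
    exact hp h1 hvs

/-- Black pawns attack no white pieces. -/
theorem pawn_safe (h : AtNode T s B) (hs : ∀ w, w <:+ s → w ∈ T)
    (hT : ∀ n u, n :: u ∈ T → u ∈ T) {w : List ℕ} (hw : w ∈ T) (hn : ¬ w <:+ s) {a b : Cell}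
    (ha : IsPawnHome w a) (hab : UpDiag b a) : B b ≠ wPawn := by
  intro hb
  rcases ha.upDiag hab with hg | hj
  · rw [h.guard hw hg] at hb; simp at hb
  · rcases h.white_cases hs hj.evenCell hj.high hb with ⟨ht, -⟩ | ⟨v, -, hvs, hv⟩
    · cases w with
      | nil => exact hn List.nil_suffix
      | cons n u => exact ht u (hT n u hw) hj.isTunnel
    · obtain rfl := hv.unique hj
      exact hn hvs

/-- The diagonal neighbors of a bishop are its guards and the home of its pawn. -/
theorem _root_.Chess3D.IsBishopHome.neighbor {w : List ℕ} {a d : Cell} (ha : IsBishopHome w a)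
    (hd : IsDiagonalStep d) : IsPawnHome w (a + d) ∨ IsGuard w (a + d) := by
  by_cases h : IsPawnHome w (a + d)
  · exact .inl h
  · exact .inr ⟨⟨a, ha, by simpa using hd⟩, h⟩

/-- The bishops of the other nodes cannot move. -/
theorem bishop_blocked (h : AtNode T s B) {w : List ℕ} (hw : w ∈ T) (hn : ∀ n, ¬ (n :: w) <:+ s)
    (hws : w ≠ s) {a d : Cell} (ha : IsBishopHome w a) (hd : IsDiagonalStep d) :
    ∃ k, B (a + d) = some ⟨.black, k⟩ := by
  rcases ha.neighbor hd with hp | hg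
  · refine ⟨_, h.pawnHome hw (fun hs => ?_) hp⟩
    rcases suffix_cases hs with e | ⟨n, e⟩
    · exact hws e
    · exact hn n e
  · exact ⟨_, h.guard hw hg⟩

theorem levelBishops (h : AtNode T s B) : LevelBishops B := by
  intro a he hl ha d hd hd0
  rcases h.black_cases he hl ha with ⟨-, w, hw, hb, hn⟩ | ⟨e, -⟩ | ⟨e, -⟩
  · rcases hb.neighbor hd with hp | hg
    · exfalso
      have h1 := hp.1
      have h2 := hb.1
      simp only [Prod.fst_add, Prod.snd_add] at h1
      omega
    · exact ⟨_, h.guard hw hg⟩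
  · cases e
  · cases e

end AtNode

/-! ### The geometry of an exchange -/

/-- The step of the bishop of `w` along its tunnel. -/
def tunnelStep (w : List ℕ) : Cell := if (w.length : ℤ) % 2 = 0 then (1, 0, 1) else (-1, 0, 1)

theorem isDiagonalStep_tunnelStep (w : List ℕ) : IsDiagonalStep (tunnelStep w) := by
  unfold tunnelStep; split_ifs <;> simp [isDiagonalStep_iff]

theorem add_smul_tunnelStep (w : List ℕ) (c : Cell) (n : ℕ) :
    (c + n • tunnelStep w).2.1 = c.2.1 ∧ along w (c + n • tunnelStep w) = along w c + 2 * n ∧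
      across w (c + n • tunnelStep w) = across w c := by
  unfold tunnelStep along across
  split_ifs <;> simp <;> omega

theorem IsBishopHome.isTunnel_add_smul {w : List ℕ} {a : Cell} (ha : IsBishopHome w a) {n : ℕ}
    (hn : 1 ≤ n) : IsTunnel w (a + n • tunnelStep w) := by
  have := add_smul_tunnelStep w a n
  unfold IsBishopHome at ha
  unfold IsTunnel
  omega

theorem IsBishopHome.eq_tunnelStep {w : List ℕ} {a d : Cell} (ha : IsBishopHome w a)
    (h : IsPawnHome w (a + d)) : d = tunnelStep w := by
  have h1 := add_smul_tunnelStep w a 1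
  have : a + d = a + 1 • tunnelStep w := by
    rw [cell_eq_iff w]
    unfold IsBishopHome at ha
    unfold IsPawnHome at h
    omega
  simpa using this

/-- The bishop of a node can move to every cell of an empty tunnel. -/
theorem IsTunnel.slides {B : Board} {w : List ℕ} {a c : Cell} (hc : IsTunnel w c)
    (ha : IsBishopHome w a) (h : ∀ c, IsTunnel w c → B c = none) :
    Slides B (tunnelStep w) a c := by
  refine ⟨((along w c - along w a) / 2).toNat, ?_, ?_, fun k hk _ => h _ (ha.isTunnel_add_smul hk)⟩
  · unfold IsTunnel at hc
    unfold IsBishopHome at ha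
    omega
  · have := add_smul_tunnelStep w a ((along w c - along w a) / 2).toNat
    have he := (evenCell_iff_along w c).1 hc.evenCell
    rw [cell_eq_iff w]
    unfold IsTunnel at hc
    unfold IsBishopHome at ha
    omega

theorem IsBishopHome.cell_unique {w : List ℕ} {a b : Cell} (ha : IsBishopHome w a)
    (hb : IsBishopHome w b) : a = b := by
  rw [cell_eq_iff w]
  unfold IsBishopHome at ha hb
  omega

theorem IsPawnHome.cell_unique {w : List ℕ} {a b : Cell} (ha : IsPawnHome w a)
    (hb : IsPawnHome w b) : a = b := by
  rw [cell_eq_iff w]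
  unfold IsPawnHome at ha hb
  omega

theorem exists_isJunction (w : List ℕ) : ∃ c, IsJunction w c :=
  ⟨frameCell w (parentSlot w) (w.length - 1) (slot w), by
    have := frameCell_spec w (parentSlot w) (w.length - 1) (slot w)
    unfold IsJunction; omega⟩

/-- The two covers of a cell far enough into the tunnel. They are adjacent, and the tunnels that may
run through them are perpendicular to that of `w`. -/
theorem IsTunnel.exists_covers {w : List ℕ} {c : Cell} (hc : IsTunnel w c)
    (h : 2 * parentSlot w + 2 ≤ along w c) :
    ∃ x y, IsCover w x ∧ IsCover w y ∧ UpDiag x c ∧ UpDiag y c ∧ along w y = along w x + 2 := by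
  have he := (evenCell_iff_along w c).1 hc.evenCell
  obtain ⟨x, hx⟩ : ∃ x, x = frameCell w (along w c / 2) (w.length - 1) (slot w + 1) := ⟨_, rfl⟩
  obtain ⟨y, hy⟩ : ∃ y, y = frameCell w (along w c / 2 + 1) (w.length - 1) (slot w + 1) := ⟨_, rfl⟩
  have h1 := frameCell_spec w (along w c / 2) (w.length - 1) (slot w + 1)
  have h2 := frameCell_spec w (along w c / 2 + 1) (w.length - 1) (slot w + 1)
  rw [← hx] at h1
  rw [← hy] at h2
  refine ⟨x, y, ?_⟩
  rw [upDiag_iff w, upDiag_iff w]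
  unfold IsTunnel at hc
  unfold IsCover
  omega

/-- Far enough into the tunnel, every cell is covered by a cell that is on no tunnel. -/
theorem IsTunnel.exists_cover {w : List ℕ} {c : Cell} (hc : IsTunnel w c)
    (h : 2 * parentSlot w + 2 ≤ along w c) :
    ∃ x, IsCover w x ∧ UpDiag x c ∧ ∀ v, ¬ IsTunnel v x := by
  obtain ⟨x, y, hx, hy, hxc, hyc, hxy⟩ := hc.exists_covers h
  by_cases h' : ∃ v, IsTunnel v x
  · obtain ⟨v, hv⟩ := h'
    refine ⟨y, hy, hyc, fun u hu => ?_⟩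
    -- The two slots would differ by one.
    unfold IsTunnel at hu hv
    unfold IsCover at hx hy
    rcases slot_separated u v with e | e
    · subst e
      rcases frame_eq_or_swap w u with ⟨hp, hf⟩ | ⟨hp, hf⟩ <;> have := hf x <;> have := hf y <;> omega
    · rcases frame_eq_or_swap w u with ⟨hp, hf⟩ | ⟨hp, hf⟩ <;>
        rcases frame_eq_or_swap w v with ⟨hp', hf'⟩ | ⟨hp', hf'⟩ <;>
        have := hf y <;> have := hf' x <;> omega
  · exact ⟨x, hx, hxc, fun v hv => h' ⟨v, hv⟩⟩

theorem IsJunction.along_parent {n : ℕ} {w : List ℕ} {c : Cell} (h : IsJunction (n :: w) c) :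
    along w c = 2 * slot (n :: w) ∨ along w c = 2 * slot (n :: w) + 2 := by
  unfold IsJunction at h
  rcases frame_eq_or_swap (n :: w) w with ⟨hp, hf⟩ | ⟨hp, hf⟩
  · simp only [List.length_cons] at hp; omega
  · have := hf c; omega

/-- No tunnel passes through the cells that cover a junction. -/
theorem IsJunction.not_isTunnel_cover {n : ℕ} {w v : List ℕ} {x c : Cell}
    (h : IsJunction (n :: w) c) (hx : IsCover w x) (hxc : UpDiag x c) : ¬ IsTunnel v x := by
  intro hv
  have ha := h.along_parent
  rw [upDiag_iff w] at hxc
  unfold IsTunnel at hv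
  unfold IsCover at hx
  rcases slot_separated v (n :: w) with e | e
  · subst e
    simp only [List.length_cons] at hv
    omega
  · rcases frame_eq_or_swap v w with ⟨hp, hf⟩ | ⟨hp, hf⟩ <;> have := hf x <;> omega

theorem IsJunction.exists_covers {n : ℕ} {w : List ℕ} {c : Cell} (h : IsJunction (n :: w) c) :
    ∃ x y, x ≠ y ∧ IsCover w x ∧ IsCover w y ∧ UpDiag x c ∧ UpDiag y c := by
  have h1 := h.along_parent
  have h2 := parentSlot_lt w
  have h3 := parentSlot_lt (n :: w)
  simp only [parentSlot] at h3
  obtain ⟨x, y, hx, hy, hxc, hyc, hxy⟩ := h.isTunnel.exists_covers (by omega)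
  refine ⟨x, y, ?_, hx, hy, hxc, hyc⟩
  rintro rfl
  omega

namespace AtNode

variable {T : Set (List ℕ)} {s : List ℕ} {B : Board}

/-- Every cell of the tunnel of `s` is attacked by a white pawn: its first two cells by the pawn on
the junction, the others by a cover. -/
theorem exists_capture (h : AtNode T s B) (hs : s ∈ T) (hT : ∀ w, w <:+ s → w ∈ T) {c : Cell}
    (hc : IsTunnel s c) : ∃ x, UpDiag x c ∧ B x = wPawn := by
  by_cases hl : 2 * parentSlot s + 2 ≤ along s c
  · obtain ⟨x, hx, hxc, ht⟩ := hc.exists_cover hl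
    exact ⟨x, hxc, h.cover hs hx (fun v _ => ht v) hT⟩
  · obtain ⟨x, hx, hxw⟩ := h.junction
    refine ⟨x, ?_, hxw⟩
    have he := (evenCell_iff_along s c).1 hc.evenCell
    rw [upDiag_iff s]
    unfold IsTunnel at hc
    unfold IsJunction at hx
    omega

/-- The junction of a child of `s` is attacked by covers only. -/
theorem isCover_of_upDiag (h : AtNode T s B) (hT : ∀ w, w <:+ s → w ∈ T) {n : ℕ} {x c : Cell}
    (hc : IsJunction (n :: s) c) (hx : B x = wPawn) (hxc : UpDiag x c) : IsCover s x := by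
  have he := hxc.evenCell_iff.2 hc.evenCell
  have ha := hc.along_parent
  have ht := hc.isTunnel
  have h2 := parentSlot_lt s
  have h3 := parentSlot_lt (n :: s)
  have hx' := (upDiag_iff s x c).1 hxc
  simp only [parentSlot] at h3
  unfold IsTunnel at ht
  rcases h.white_cases hT he (by omega) hx with ⟨-, v, -, hv⟩ | ⟨v, -, -, hv⟩
  · unfold IsCover at hv
    rcases slot_separated v s with e | e
    · exact e ▸ hv
    · rcases frame_eq_or_swap v s with ⟨hp, hf⟩ | ⟨hp, hf⟩ <;> have := hf x <;> omega
  · exfalso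
    unfold IsJunction at hv
    rcases slot_separated v s with e | e
    · subst e; omega
    · rcases frame_eq_or_swap v s with ⟨hp, hf⟩ | ⟨hp, hf⟩ <;> have := hf x <;> omega

/-- The bishop of `s` can move only within its tunnel. -/
theorem isTunnel_of_slides (h : AtNode T s B) (hs : s ∈ T) {a b d : Cell} (ha : IsBishopHome s a)
    (hd : IsDiagonalStep d) (hab : Slides B d a b) (hb : ∀ k, B b ≠ some ⟨.black, k⟩) :
    IsTunnel s b := by
  rcases ha.neighbor hd with hp | hg
  · obtain ⟨n, hn, rfl, -⟩ := hab
    rw [ha.eq_tunnelStep hp]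
    exact ha.isTunnel_add_smul hn
  · have hk := h.guard hs hg
    rcases hab.first with rfl | e
    · exact absurd hk (hb _)
    · rw [e] at hk; cases hk

end AtNode

/-! ### The exchange on a junction -/

namespace AtNode

variable {T : Set (List ℕ)} {s : List ℕ} {B : Board}

/-- After the bishop of `s` has gone to the junction `l` of a child, white has captured it with a
cover, black has recaptured with the pawn of the child, and white has recaptured with another cover,
the game has reached the child. -/
theorem exchange (h : AtNode T s B) {n : ℕ} {a l x c y : Cell} (ha : IsBishopHome s a)
    (hl : IsJunction (n :: s) l) (hc : IsPawnHome (n :: s) c) (hx : IsCover s x)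
    (hy : IsCover s y) (hyB : B y = wPawn) (hyx : y ≠ x) :
    AtNode T (n :: s)
      (movePiece (movePiece (movePiece (movePiece B a l) x l) c l) y l) := by
  have hls : ∀ w, ¬ IsBlackSite w l := fun w => hl.not_isBlackSite
  have hla : l ≠ a := by rintro rfl; exact hls _ (.inl ha)
  have hlc : l ≠ c := by rintro rfl; exact hls _ (.inr (.inl hc))
  have hya : y ≠ a := by rintro rfl; exact hy.not_isBlackSite (.inl ha)
  have hyc : y ≠ c := by rintro rfl; exact hy.not_isBlackSite (.inr (.inl hc))
  have hyl : y ≠ l := by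
    rintro rfl
    have h1 := hl.1
    have h2 := hy.1
    simp only [List.length_cons] at h1
    omega
  have app : ∀ e, movePiece (movePiece (movePiece (movePiece B a l) x l) c l) y l e =
      if e = l then wPawn else if e = y ∨ e = c ∨ e = x ∨ e = a then none else B e := by
    intro e
    simp only [movePiece_apply]
    by_cases h1 : e = l
    · subst h1; simp [hyl.symm, hyl, hyc, hyx, hya, hyB]
    · by_cases h2 : e = y <;> by_cases h3 : e = c <;> by_cases h4 : e = x <;>
        by_cases h5 : e = a <;> simp [h1, h2, h3, h4, h5]
      all_goals simp_all
  refine ⟨fun e => ?_, fun m u hu e he => ?_, fun m u hu e he => ?_, l, hl, ?_⟩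
  · rw [app]
    split_ifs with h1 h2
    · subst h1
      exact .inr ⟨n, s, List.suffix_rfl, .inr ⟨rfl, hl⟩⟩
    · refine .inr ⟨n, s, List.suffix_rfl, .inl ⟨rfl, ?_⟩⟩
      rcases h2 with rfl | rfl | rfl | rfl
      · exact .inr (.inr hy)
      · exact .inr (.inl hc)
      · exact .inr (.inr hx)
      · exact .inl ha
    · rcases h.cell e with h | ⟨m, u, hu, h⟩
      · exact .inl h
      · exact .inr ⟨m, u, hu.trans (List.suffix_cons _ _), h⟩
  · rw [app, if_neg (by rintro rfl; exact hls _ (.inl he))]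
    split_ifs with h2
    · rfl
    · rcases List.suffix_cons_iff.1 hu with e' | hu
      · obtain ⟨rfl, rfl⟩ := List.cons.inj e'
        exact absurd (.inr (.inr (.inr (he.cell_unique ha)))) h2
      · exact h.home m u hu e he
  · rw [app, if_neg (by rintro rfl; exact hls _ (.inr (.inl he)))]
    split_ifs with h2
    · rfl
    · rcases List.suffix_cons_iff.1 hu with e' | hu
      · rw [e'] at he
        exact absurd (.inr (.inl (he.cell_unique hc))) h2
      · exact h.pawn m u hu e he
  · rw [app, if_pos rfl]

end AtNode

/-! ### Playing from a node to a child -/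

/-- In a frozen position no king is in danger, so that all moves on the high even cells that follow
the movement rules are legal. -/
theorem Frozen.legalMove {p : Position} (hB : Frozen p.board) {a b : Cell} (ha : EvenCell a)
    (hal : -5 ≤ a.2.1) (hb : EvenCell b) (hbl : -5 ≤ b.2.1) (hm : CanMove p.board p.turn a b) :
    LegalMove p (p.move a b) := by
  have hB' := hB.movePiece ha hal hb hbl
  refine ⟨?_, rfl, ⟨a, b, hm, rfl⟩, ?_⟩
  · rw [Position.OpponentInCheck]
    cases p.turn with
    | white => exact hB.not_inCheck_black
    | black => exact hB.not_inCheck_white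
  · change ¬ InCheck (Chess3D.movePiece p.board a b) p.turn
    cases p.turn with
    | white => exact hB'.not_inCheck_white
    | black => exact hB'.not_inCheck_black

theorem canMove_white_pawn {B : Board} {a b : Cell} {k : Kind} (ha : B a = wPawn)
    (hb : B b = some ⟨.black, k⟩) (hab : UpDiag a b) : CanMove B .white a b :=
  ⟨_, ha, rfl, .inl ⟨_, hb, rfl, pieceAttacks_white_pawn.2 hab⟩⟩

theorem canMove_black_pawn {B : Board} {a b : Cell} {k : Kind} (ha : B a = bPawn)
    (hb : B b = some ⟨.white, k⟩) (hab : UpDiag b a) : CanMove B .black a b :=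
  ⟨_, ha, rfl, .inl ⟨_, hb, rfl, pieceAttacks_black_pawn.2 hab⟩⟩

namespace AtNode

variable {T : Set (List ℕ)} {s : List ℕ} {p : Position}

/-- If white wins at all children of `s`, then also at `s`. -/
theorem hasValue_of_children (h : AtNode T s p.board) (ht : p.turn = .black) (hs : s ∈ T)
    (hsT : ∀ w, w <:+ s → w ∈ T) (hT : ∀ n u, n :: u ∈ T → u ∈ T)
    (ih : ∀ n, n :: s ∈ T → ∀ q : Position, AtNode T (n :: s) q.board → q.turn = .black →
      HasValue q) : HasValue p := by
  have hB := h.frozen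
  refine hB.hasValue h.levelBishops ht ?_
  rintro a l hae hal hm hleg
  -- Only the bishop of `s` can move.
  have hbish : p.board a = bBishop ∧ IsBishopHome s a ∧ IsTunnel s l := by
    rcases hm with ⟨ha, hu, k, hk⟩ | ⟨ha, hnb, d, hd, hsl⟩
    · exfalso
      rcases h.black_cases hae hal ha with ⟨e, -⟩ | ⟨-, w, hw, -, hp, hn⟩ | ⟨e, -⟩
      · cases e
      · rcases hB.white_kind hk with ⟨rfl, -⟩ | ⟨rfl, -⟩
        · exact h.pawn_safe hsT hT hw hn hp hu hk
        · have := hu.1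
          simp only at this
          omega
      · cases e
    · rcases h.black_cases hae hal ha with ⟨-, w, hw, hb, hn⟩ | ⟨e, -⟩ | ⟨e, -⟩
      · by_cases hws : w = s
        · subst hws
          exact ⟨ha, hb, h.isTunnel_of_slides hs hb hd hsl hnb⟩
        · exfalso
          obtain ⟨k, hk⟩ := h.bishop_blocked hw hn hws hb hd
          rcases hsl.first with rfl | e
          · exact hnb k hk
          · rw [e] at hk; cases hk
      · cases e
      · cases e
  obtain ⟨ha, hah, hl⟩ := hbish
  clear hm
  have hlB := h.tunnel hs hl
  have hla : l ≠ a := by rintro rfl; rw [ha] at hlB; cases hlB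
  have hB1 := hB.movePiece hae hal hl.evenCell hl.high
  -- The bishop is captured.
  obtain ⟨x, hxl, hx⟩ := h.exists_capture hs hsT hl
  have hxa : x ≠ a := by rintro rfl; rw [ha] at hx; cases hx
  have hxne : x ≠ l := by rintro rfl; rw [hlB] at hx; cases hx
  have hxe := hxl.evenCell_iff.2 hl.evenCell
  have hxh : -5 ≤ x.2.1 := by
    have h1 := hxl.1
    have h2 := hl.1
    omega
  have hB2 := hB1.movePiece hxe hxh hl.evenCell hl.high
  have leg2 : LegalMove (p.move a l) ((p.move a l).move x l) := by
    refine Frozen.legalMove hB1 hxe hxh hl.evenCell hl.high ?_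
    rw [show (p.move a l).turn = .white by simp [Position.move, ht, Color.other]]
    refine canMove_white_pawn (k := .bishop) ?_ ?_ hxl
    · change movePiece p.board a l x = _
      rw [movePiece_of_ne _ hxa hxne, hx]
    · change movePiece p.board a l l = _
      rw [movePiece_target _ hla, ha]
  refine .of_white (by simp [Position.move, ht, Color.other]) leg2 ?_
  have app : ∀ c, ((p.move a l).move x l).board c =
      if c = x then none else if c = l then wPawn else if c = a then none else p.board c := by
    intro c
    change movePiece (movePiece p.board a l) x l c = _
    simp only [movePiece_apply]
    split_ifs <;> simp_all
  -- All bishops are blocked now.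
  have blocked : ∀ c, EvenCell c → -5 ≤ c.2.1 → ((p.move a l).move x l).board c = bBishop →
      ∀ d, IsDiagonalStep d → ∃ k, ((p.move a l).move x l).board (c + d) = some ⟨.black, k⟩ := by
    intro c hce hcl hc d hd
    rw [app] at hc
    split_ifs at hc with h1 h2 h3
    · simp at hc
    rcases h.black_cases hce hcl hc with ⟨-, w, hw, hb, hn⟩ | ⟨e, -⟩ | ⟨e, -⟩
    · have hws : w ≠ s := by rintro rfl; exact h3 (hb.cell_unique hah)
      obtain ⟨k, hk⟩ := h.bishop_blocked hw hn hws hb hd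
      refine ⟨k, ?_⟩
      rw [app, if_neg, if_neg, if_neg, hk]
      · intro e
        rcases hb.neighbor hd with hp | hg
        · rw [e] at hp; exact hp.not_isBishopHome hah
        · rw [e] at hg; exact hah.not_isGuard hg
      · intro e; rw [e, hlB] at hk; cases hk
      · intro e; rw [e, hx] at hk; simp at hk
    · cases e
    · cases e
  refine Frozen.hasValue hB2 (fun c hce hcl hc d hd _ => blocked c hce hcl hc d hd)
    (by simp [Position.move, ht, Color.other]) ?_
  rintro c b hce hcl hm -
  rcases hm with ⟨hc, hu, k, hk⟩ | ⟨hc, hnb, d, hd, hsl⟩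
  swap
  · exfalso
    obtain ⟨k, hk⟩ := blocked c hce hcl hc d hd
    rcases hsl.first with rfl | e
    · exact hnb k hk
    · rw [e] at hk; cases hk
  rw [app] at hc
  split_ifs at hc with hcx hcl' hca
  · simp at hc
  rcases h.black_cases hce hcl hc with ⟨e, -⟩ | ⟨-, w, hw, hw0, hp, hn⟩ | ⟨e, -⟩
  · cases e
  swap
  · cases e
  -- The only capture open to a black pawn is on a junction, by the pawn of the child.
  have hbl : b = l := by
    by_contra hbl
    rw [app, if_neg, if_neg hbl] at hk
    · split_ifs at hk
      rcases hB.white_kind hk with ⟨rfl, -⟩ | ⟨rfl, -⟩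
      · exact h.pawn_safe hsT hT hw hn hp hu hk
      · have := hu.1
        simp only at this
        omega
    · intro e; rw [if_pos e] at hk; cases hk
  subst hbl
  rcases hp.upDiag hu with hg | hj
  · exact absurd hg hl.not_isGuard
  cases w with
  | nil => exact absurd rfl hw0
  | cons n u =>
  obtain rfl := hj.isTunnel.unique hl
  -- At least one of the two covers of the junction is still there to recapture.
  obtain ⟨y, hyx, hy, hyb⟩ : ∃ y, y ≠ x ∧ IsCover u y ∧ UpDiag y b := by
    obtain ⟨x1, x2, hne, h1, h2, h3, h4⟩ := hj.exists_covers
    by_cases e : x1 = x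
    · exact ⟨x2, fun e' => hne (e.trans e'.symm), h2, h4⟩
    · exact ⟨x1, e, h1, h3⟩
  have hyB := h.cover hs hy (fun v _ => hj.not_isTunnel_cover hy hyb) hsT
  have hyb' : y ≠ b := by rintro rfl; rw [hlB] at hyB; cases hyB
  have hyc : y ≠ c := by rintro rfl; rw [hc] at hyB; simp at hyB
  have hya : y ≠ a := by rintro rfl; rw [ha] at hyB; simp at hyB
  have hB3 := hB2.movePiece hce hcl hl.evenCell hl.high
  set q := (p.move a b).move x b with hq
  have leg4 : LegalMove (q.move c b) ((q.move c b).move y b) := by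
    refine Frozen.legalMove hB3 hy.evenCell hy.high hl.evenCell hl.high ?_
    rw [show (q.move c b).turn = .white by simp [hq, Position.move, ht, Color.other]]
    refine canMove_white_pawn (k := .pawn) ?_ ?_ hyb
    · change movePiece q.board c b y = _
      rw [movePiece_of_ne _ hyc hyb', app, if_neg hyx, if_neg hyb', if_neg hya, hyB]
    · change movePiece q.board c b b = _
      rw [movePiece_target _ (Ne.symm hcl'), app, if_neg hcx, if_neg hcl', if_neg hca, hc]
  refine .of_white (by simp [hq, Position.move, ht, Color.other]) leg4 (ih n hw _ ?_ ?_)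
  · exact h.exchange hah hj hp (h.isCover_of_upDiag hsT hj hx hxl) hy hyB hyx
  · simp [hq, Position.move, ht, Color.other]

/-- Black can head for any child of `s`, and white then has no choice; on the way white makes two
moves. -/
theorem exists_child (h : AtNode T s p.board) (ht : p.turn = .black) (hs : s ∈ T)
    (hsT : ∀ w, w <:+ s → w ∈ T) {α : Ordinal.{0}} (hα : ValueLE p α) {n : ℕ}
    (hn : n :: s ∈ T) :
    ∃ q : Position, AtNode T (n :: s) q.board ∧ q.turn = .black ∧ ∃ β < α, ValueLE q β := by
  have hB := h.frozen
  obtain ⟨a, hah⟩ := exists_isBishopHome s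
  obtain ⟨l, hj⟩ := exists_isJunction (n :: s)
  obtain ⟨c, hc⟩ := exists_isPawnHome (n :: s)
  have hl := hj.isTunnel
  have hlB := h.tunnel hs hl
  have ha := h.bishopHome hs hah
  have hcB := h.pawnHome hn not_suffix_cons hc
  have hcl : c ≠ l := by rintro rfl; exact hj.not_isBlackSite (.inr (.inl hc))
  have hca : c ≠ a := by rintro rfl; exact hc.not_isBishopHome hah
  have hla : l ≠ a := by rintro rfl; rw [ha] at hlB; cases hlB
  have hB1 := hB.movePiece (IsBlackSite.evenCell (.inl hah)) (IsBlackSite.high (.inl hah))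
    hl.evenCell hl.high
  have leg1 : LegalMove p (p.move a l) := by
    refine hB.legalMove (IsBlackSite.evenCell (.inl hah)) (IsBlackSite.high (.inl hah))
      hl.evenCell hl.high ?_
    rw [ht]
    exact ⟨_, ha, rfl, .inr (.inl ⟨hlB, by simp, tunnelStep s, isDiagonalStep_tunnelStep s,
      hl.slides hah fun _ => h.tunnel hs⟩)⟩
  have v1 := hα.of_black ht leg1
  -- White's reply.
  obtain ⟨q2, ⟨-, hq2t, ⟨x, b, hm, hq2b⟩, -⟩, β, hβ, v2⟩ :=
    v1.of_white (by simp [Position.move, ht, Color.other]) (Frozen.not_inCheck_black hB1)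
  obtain rfl := Position.eq_move hq2t hq2b
  rw [show (p.move a l).turn = .white by simp [Position.move, ht, Color.other]] at hm
  obtain ⟨hxe, hxh, hx1, hxb, k, hb1⟩ := Frozen.white_move hB1 hm
  change movePiece p.board a l x = _ at hx1
  change movePiece p.board a l b = _ at hb1
  have hx : p.board x = wPawn ∧ x ≠ a ∧ x ≠ l := by
    rw [movePiece_apply] at hx1
    split_ifs at hx1 with h1 h2
    · rw [ha] at hx1; simp at hx1
    · exact ⟨hx1, h1, h2⟩
  obtain ⟨hx, hxa, hxl⟩ := hx
  -- Nothing but the bishop can be captured, as no piece was hanging before.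
  obtain rfl : b = l := by
    by_contra hbl
    rw [movePiece_apply] at hb1
    split_ifs at hb1
    exact h.not_hanging hsT hxe hxh hx hb1 hxb
  have hxc := h.isCover_of_upDiag hsT hj hx hxb
  have hB2 := hB1.movePiece hxe hxh hl.evenCell hl.high
  have hcx : c ≠ x := by rintro rfl; rw [hcB] at hx; simp at hx
  set q := (p.move a b).move x b with hq
  have app : ∀ e, q.board e =
      if e = x then none else if e = b then wPawn else if e = a then none else p.board e := by
    intro e
    change movePiece (movePiece p.board a b) x b e = _
    simp only [movePiece_apply]
    split_ifs <;> simp_all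
  -- Black recaptures with the pawn of the child, and white can only capture that pawn.
  have hqc : q.board c = bPawn := by rw [app, if_neg hcx, if_neg hcl, if_neg hca, hcB]
  have leg3 : LegalMove q (q.move c b) := by
    refine Frozen.legalMove hB2 (IsBlackSite.evenCell (.inr (.inl hc)))
      (IsBlackSite.high (.inr (.inl hc))) hl.evenCell hl.high ?_
    rw [show q.turn = .black by simp [hq, Position.move, ht, Color.other]]
    refine canMove_black_pawn (k := .pawn) hqc ?_ (hj.upDiag_pawnHome hc)
    rw [app, if_neg (Ne.symm hxl), if_pos rfl]
  have v3 := v2.of_black (by simp [hq, Position.move, ht, Color.other]) leg3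
  have hB3 := hB2.movePiece (IsBlackSite.evenCell (.inr (.inl hc)))
    (IsBlackSite.high (.inr (.inl hc))) hl.evenCell hl.high
  obtain ⟨q4, ⟨-, hq4t, ⟨y, b', hm, hq4b⟩, -⟩, γ, hγ, v4⟩ :=
    v3.of_white (by simp [hq, Position.move, ht, Color.other]) (Frozen.not_inCheck_black hB3)
  obtain rfl := Position.eq_move hq4t hq4b
  rw [show (q.move c b).turn = .white by simp [hq, Position.move, ht, Color.other]] at hm
  obtain ⟨hye, hyh, hy1, hyb, k', hb1'⟩ := Frozen.white_move hB3 hm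
  change movePiece q.board c b y = _ at hy1
  change movePiece q.board c b b' = _ at hb1'
  obtain ⟨hy, hyx⟩ : p.board y = wPawn ∧ y ≠ x := by
    rw [movePiece_apply] at hy1
    split_ifs at hy1 with h1 h2
    · rw [hqc] at hy1; simp at hy1
    · rw [app] at hy1
      split_ifs at hy1 with h3 h4
      exact ⟨hy1, h3⟩
  obtain rfl : b' = b := by
    by_contra hbl
    rw [movePiece_apply] at hb1'
    split_ifs at hb1'
    rw [app] at hb1'
    split_ifs at hb1'
    exact h.not_hanging hsT hye hyh hy hb1' hyb
  exact ⟨_, h.exchange hah hj hc hxc (h.isCover_of_upDiag hsT hj hy hyb) hy hyx,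
    by simp [hq, Position.move, ht, Color.other], γ, hγ.trans hβ, v4⟩

end AtNode

/-! ### The trees of the countable ordinals -/

/-- The rank of a node, for a sequence `f` of ordinals that label the edges: that of the root is `α`,
and that of another node is the label of its last edge, which comes first in the list. -/
def rankOf (f : ℕ → Ordinal.{0}) (α : Ordinal.{0}) : List ℕ → Ordinal.{0}
  | [] => α
  | n :: _ => f n

/-- The nodes of the tree of `α`: the paths on which the ranks decrease strictly. -/
def IsNode (f : ℕ → Ordinal.{0}) (α : Ordinal.{0}) : List ℕ → Prop
  | [] => True
  | n :: u => IsNode f α u ∧ f n < rankOf f α u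

section

variable {f : ℕ → Ordinal.{0}} {α : Ordinal.{0}}

theorem IsNode.of_suffix {s : List ℕ} (hs : IsNode f α s) : ∀ w, w <:+ s → IsNode f α w := by
  induction s with
  | nil => intro w hw; rw [List.suffix_nil.1 hw]; exact hs
  | cons n u ih =>
    intro w hw
    rcases List.suffix_cons_iff.1 hw with rfl | hw
    · exact hs
    · exact ih hs.1 w hw

theorem hasValue_of_atNode {s : List ℕ} (hs : IsNode f α s) {p : Position}
    (h : AtNode {w | IsNode f α w} s p.board) (ht : p.turn = .black) : HasValue p := by
  generalize hr : rankOf f α s = r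
  induction r using WellFoundedLT.induction generalizing s p with
  | _ r ih =>
    refine h.hasValue_of_children ht hs hs.of_suffix (fun n u hn => hn.1) fun n hn q hq hqt => ?_
    exact ih (f n) (hr ▸ hn.2) hn hq hqt rfl

/-- Against a value below the rank of `s` black would descend to a child whose rank is that value,
and the value would have dropped strictly. -/
theorem rankOf_le {s : List ℕ} (hs : IsNode f α s) (hα : ∀ γ < α, ∃ n, f n = γ)
    (hsα : rankOf f α s ≤ α) {p : Position}
    (h : AtNode {w | IsNode f α w} s p.board) (ht : p.turn = .black) {β : Ordinal.{0}}
    (hβ : ValueLE p β) : rankOf f α s ≤ β := by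
  induction β using WellFoundedLT.induction generalizing s p with
  | _ β ih =>
    by_contra hlt
    rw [not_le] at hlt
    obtain ⟨n, hn⟩ := hα β (hlt.trans_le hsα)
    have hns : IsNode f α (n :: s) := ⟨hs, hn ▸ hlt⟩
    obtain ⟨q, hq, hqt, γ, hγ, v⟩ := h.exists_child ht hs hs.of_suffix hβ hns
    have := ih γ hγ hns (hns.2.le.trans hsα) hq hqt v
    exact absurd (hn ▸ this : β ≤ γ) (not_le.2 hγ)

end

/-- The starting position that belongs to a set of nodes. -/
noncomputable def startPosition (T : Set (List ℕ)) : Position where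
  board := startBoard T
  turn := .black
  king_unique c a b ha hb := by
    have F := frozen_startBoard (T := T)
    cases c with
    | white =>
      rcases F.white_kind ha with ⟨h, -⟩ | ⟨-, h⟩ <;> cases h
    | black => rw [F.eq_kingCell ha, F.eq_kingCell hb]

/-- The labels are a sequence in which all ordinals below `α` occur. -/
theorem exists_le_mem_gameValues {α : Ordinal.{0}} (hα : α.card ≤ Cardinal.aleph0) :
    ∃ γ ∈ gameValues, α ≤ γ := by
  obtain ⟨f, hf⟩ : ∃ f : ℕ → Ordinal.{0}, ∀ γ < α, ∃ n, f n = γ := by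
    have hc : (Set.Iio α).Countable := by
      rw [← Cardinal.le_aleph0_iff_set_countable, Cardinal.mk_Iio_ordinal,
        Cardinal.lift_le_aleph0]
      exact hα
    rcases (Set.Iio α).eq_empty_or_nonempty with h | h
    · exact ⟨fun _ => 0, fun γ hγ => absurd hγ (by rw [← Set.mem_Iio, h]; exact id)⟩
    · obtain ⟨f, hf⟩ := hc.exists_eq_range h
      refine ⟨f, fun γ hγ => ?_⟩
      have : γ ∈ Set.range f := hf ▸ hγ
      exact this
  have h := atNode_nil {w | IsNode f α w}
  have hroot : IsNode f α [] := trivial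
  obtain ⟨β, hβ⟩ := hasValue_of_atNode hroot (p := startPosition {w | IsNode f α w}) h rfl
  obtain ⟨γ, h1, h2⟩ := exists_le_gameValue (α := α) hβ fun γ hγ =>
    rankOf_le hroot hf le_rfl h rfl hγ
  exact ⟨γ, ⟨_, h2⟩, h1⟩

theorem gameValues_eq : gameValues = Set.Iio (Ordinal.omega 1) := by
  ext α
  refine ⟨lt_omega_one_of_mem_gameValues, fun h => ?_⟩
  obtain ⟨γ, hγ, hle⟩ := exists_le_mem_gameValues (card_le_aleph0_iff.2 h)
  exact mem_gameValues_of_le hγ hle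

end Chess3D

theorem mainTheorem1 :
    (∀ α : Ordinal.{0}, α.card ≤ Cardinal.aleph0 →
      ∃ p : Chess3D.Position, Chess3D.gameValue p = some α) ∧
    BddAbove Chess3D.gameValues ∧ Chess3D.omegaOneChess = Ordinal.omega 1 := by
  have h := Chess3D.gameValues_eq
  refine ⟨fun α hα => ?_, ?_, ?_⟩
  · have : α ∈ Chess3D.gameValues := h ▸ Chess3D.card_le_aleph0_iff.1 hα
    exact this
  · rw [h]; exact bddAbove_Iio
  · rw [Chess3D.omegaOneChess, h]
    exact (Cardinal.isSuccLimit_omega 1).isLUB_Iio.csSup_eq ⟨0, Ordinal.omega_pos 1⟩
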